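/- Let $A_p^x$ ($p\in\{1,2,3\}$, $x\in\{0,1\}$) be $\pm1$-valued observables on $\mathbb C^2$, that is, Hermitian $2\times 2$ matrices with $(A_p^x)^2=\mathbb 1$ (the degenerate cases $\pm\mathbb 1$ are allowed); equivalently, $A_p^x=M_0-M_1$ for a two-outcome projective measurement $\{M_0,M_1\}$. For a density matrix $\rho$ on $(\mathbb C^2)^{\otimes 3}$ let $\langle M\rangle=\mathrm{tr}(\rho M)$, where $A_p^x$ acts on the $p$-th qubit, and put $$S_3=\Big\langle A_1^0A_2^0A_3^0-A_1^1A_2^1A_3^1+A_1^0A_2^0A_3^1+A_1^0A_2^1A_3^0+A_1^1A_2^0A_3^0-A_1^0A_2^1A_3^1-A_1^1A_2^0A_3^1-A_1^1A_2^1A_3^0\Big\rangle,$$ $$R_2=\sum_{i=0,1}\Big\langle A_1^{i}A_2^{i\oplus1}+A_1^{i}A_3^{i\oplus1}+A_2^{i}A_3^{i\oplus1}\Big\rangle .$$ A pure three-qubit stabilizer state is a unit vector $|\psi\rangle$ with $s|\psi\rangle=|\psi\rangle$ for all $s\in\mathcal S$, where $\mathcal S$ is an abelian subgroup of the three-qubit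 Pauli group $\{i^k\sigma_1\otimes\sigma_2\otimes\sigma_3 : k\in\mathbb Z,\ \sigma_j\in\{\mathbb 1,X,Y,Z\}\}$ that contains no multiple of the identity other than the identity and is generated by three independent elements. Then $$B=S_3+R_2\le 6$$ for all observables as above and for every pure three-qubit stabilizer state $\rho=|\psi\rangle\langle\psi|$, and also for every mixed three-qubit stabilizer state, i.e. every $\rho$ in the convex hull of the density matrices $|\psi\rangle\langle\psi|$ of pure stabilizer states. -/

import Mathlib

noncomputable section

namespace StabBell

open Matrix

/-- Labels of the computational basis of the `n`-qubit space `(ℂ²)^{⊗ n}`. -/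
abbrev Basis (n : ℕ) : Type := Fin n → Fin 2

/-- Operators on `(ℂ²)^{⊗ n}`, as matrices in the computational basis. -/
abbrev Op (n : ℕ) : Type := Matrix (Basis n) (Basis n) ℂ

/-- The operator `A₀ ⊗ A₁ ⊗ ⋯ ⊗ A_{n-1}`. -/
def tensorOp {n : ℕ} (A : Fin n → Matrix (Fin 2) (Fin 2) ℂ) : Op n :=
  Matrix.of fun x y => ∏ j, A j (x j) (y j)

/-- The single-qubit Pauli matrices `I, X, Y, Z`. -/
def pauli : Fin 4 → Matrix (Fin 2) (Fin 2) ℂ :=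
  ![1, !![0, 1; 1, 0], !![0, -Complex.I; Complex.I, 0], !![1, 0; 0, -1]]

/-- Membership in the `n`-qubit Pauli group: `i^k σ_{p₀} ⊗ ⋯ ⊗ σ_{p_{n-1}}`. -/
def IsPauli {n : ℕ} (M : Op n) : Prop :=
  ∃ (k : ℕ) (p : Fin n → Fin 4), M = Complex.I ^ k • tensorOp (fun j => pauli (p j))

/-- An `n`-qubit stabilizer group: an abelian group of Pauli operators which contains no multiple
of the identity other than the identity, and which is generated by `n` independent elements. -/
structure IsStabilizerGroup {n : ℕ} (S : Subgroup (Matrix.unitaryGroup (Basis n) ℂ)) : Prop where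
  pauli : ∀ s ∈ S, IsPauli (s : Op n)
  comm : ∀ s ∈ S, ∀ t ∈ S, s * t = t * s
  phase : ∀ s ∈ S, ∀ c : ℂ, (s : Op n) = c • (1 : Op n) → c = 1
  generators : ∃ g : Fin n → Matrix.unitaryGroup (Basis n) ℂ,
    Subgroup.closure (Set.range g) = S ∧ ∀ j, g j ∉ Subgroup.closure (g '' {j}ᶜ)

/-- A pure `n`-qubit stabilizer state: a unit vector fixed by all the elements of some stabilizer
group. -/
def IsStabilizerState {n : ℕ} (ψ : EuclideanSpace ℂ (Basis n)) : Prop :=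
  ‖ψ‖ = 1 ∧ ∃ S : Subgroup (Matrix.unitaryGroup (Basis n) ℂ), IsStabilizerGroup S ∧
    ∀ s ∈ S, (s : Op n) *ᵥ (fun x => ψ x) = fun x => ψ x

/-- The operator `|ψ⟩⟨ψ|`. -/
def ketbra {n : ℕ} (ψ : EuclideanSpace ℂ (Basis n)) : Op n :=
  Matrix.of fun x y => ψ x * star (ψ y)

/-- The stabilizer polytope: the convex hull of the density matrices of pure stabilizer states. -/
def stabilizerPolytope (n : ℕ) : Set (Op n) :=
  convexHull ℝ {ρ | ∃ ψ : EuclideanSpace ℂ (Basis n), IsStabilizerState ψ ∧ ρ = ketbra ψ}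

/-- A `±1`-valued observable of one qubit, `A = M₀ - M₁` for a two-outcome projective measurement
`{M₀, M₁}`; the degenerate cases `A = 1` and `A = -1` are included. -/
def IsDichotomic (A : Matrix (Fin 2) (Fin 2) ℂ) : Prop :=
  A.IsHermitian ∧ A * A = 1

/-- The expectation value `tr(ρ M)`, which is real if `ρ` and `M` are Hermitian. -/
def expect {n : ℕ} (ρ M : Op n) : ℝ := (ρ * M).trace.re

/-- `⟨A₁^i A₂^j A₃^k⟩`, where `A p x` is the observable of the party `p` for the setting `x`. -/
def corr3 (ρ : Op 3) (A : Fin 3 → Fin 2 → Matrix (Fin 2) (Fin 2) ℂ) (i j k : Fin 2) : ℝ :=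
  expect ρ (tensorOp ![A 0 i, A 1 j, A 2 k])

/-- The Svetlichny polynomial. -/
def S3 (ρ : Op 3) (A : Fin 3 → Fin 2 → Matrix (Fin 2) (Fin 2) ℂ) : ℝ :=
  ∑ i : Fin 2, (-1 : ℝ) ^ (i : ℕ) * corr3 ρ A i i i
    + (corr3 ρ A 0 0 1 + corr3 ρ A 0 1 0 + corr3 ρ A 1 0 0)
    - (corr3 ρ A 0 1 1 + corr3 ρ A 1 0 1 + corr3 ρ A 1 1 0)

/-- The two-body terms; `i + 1` is addition modulo `2`. -/
def R2 (ρ : Op 3) (A : Fin 3 → Fin 2 → Matrix (Fin 2) (Fin 2) ℂ) : ℝ :=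
  ∑ i : Fin 2, (expect ρ (tensorOp ![A 0 i, A 1 (i + 1), 1])
    + expect ρ (tensorOp ![A 0 i, 1, A 2 (i + 1)])
    + expect ρ (tensorOp ![1, A 1 i, A 2 (i + 1)]))

end StabBell

end

/-!
# A three-party Bell inequality for stabilizer states

The expression `B = S₃ + R₂` is symmetric under permutations of the parties and affine in each
observable, and it depends on the state only through the trilinear form
`(a, b, c) ↦ tr(ρ (a ⊗ b ⊗ c))`. As `B` is affine in `ρ`, only pure stabilizer states matter
(`convex_setOf_bell_le`).

A stabilizer group has eight elements, with distinct Pauli labels, and Pauli operators that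
anticommute with one of them have expectation value zero. Three mechanisms give the bound `6`.

* If two parties have one observable each that acts as a scalar, then the correlations have a local
  hidden variable model, and `6` is the classical bound (`bell_le_of_det`).
* If both observables of one party act as scalars and the marginals of the others vanish, then `B`
  is a combination of four correlators with coefficients whose absolute values sum to `6`
  (`bell_le_of_marginals`).
* For a GHZ state and observables with unit Bloch vectors `(w, ζ)`, `w` complex and `ζ` real, the
  expression `S₃` involves only the components `w` and is at most `∑ |w|²` (`svetlichny_le`),
  whereas `R₂` is at most `∑ ζ²`; there are six observables, so the sum is at most `6`. When a
  single party has an observable `±1` and the other one is not, a similar estimate holds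
  (`one_det_real_le`).

The stabilizers of weight one decide which mechanism applies. A qubit with such a stabilizer is in a
pure state and its observables act as scalars. If there are two such qubits, the first mechanism
applies. If there is one, the other two qubits are maximally mixed (`marginal_eq_zero`), so the
second applies unless some observable of theirs is `±1`, when the first does (`bell_le_of_sep₃`).
If there is none, a pigeonhole argument among the eight labels shows that the state is a GHZ state
in suitable local frames (`exists_isGHZ`), and the number of parties with an observable `±1`
decides among the three mechanisms (`IsGHZ.bell_le`).
-/

namespace StabBell

open Matrix Complex

/-! ### Trilinear forms of three-qubit states -/

/-- Operators on one qubit. -/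
abbrev M2 : Type := Matrix (Fin 2) (Fin 2) ℂ

/-- Trilinear forms on one-qubit operators. A three-qubit operator `ρ` is seen through the form
`(a, b, c) ↦ tr(ρ (a ⊗ b ⊗ c))`; unlike `ρ`, such a form makes a permutation of the parties a
permutation of arguments. -/
abbrev Tri : Type := M2 →ₗ[ℂ] M2 →ₗ[ℂ] M2 →ₗ[ℂ] ℂ

/-- The properties of a density matrix that the argument uses: normalization, and positivity on the
products of the (doubled) projections `1 + a` of dichotomic observables `a`. -/
structure IsState (F : Tri) : Prop where
  norm : F 1 1 1 = 1
  nonneg : ∀ a b c, IsDichotomic a → IsDichotomic b → IsDichotomic c →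
    0 ≤ (F (1 + a) (1 + b) (1 + c)).re

/-- The form with the last two parties exchanged; `LinearMap.flip` exchanges the first two. -/
def swapR (F : Tri) : Tri := LinearMap.lflip.toLinearMap.comp F

@[simp] lemma swapR_apply (F : Tri) (a b c : M2) : swapR F a b c = F a c b := rfl

lemma IsState.flip {F : Tri} (h : IsState F) : IsState F.flip :=
  ⟨h.norm, fun a b c ha hb hc => h.nonneg b a c hb ha hc⟩

lemma IsState.swapR {F : Tri} (h : IsState F) : IsState (swapR F) :=
  ⟨h.norm, fun a b c ha hb hc => h.nonneg a c b ha hc hb⟩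

/-- The Bell expression `S₃ + R₂` of a trilinear form. -/
def bell (F : Tri) (A B C : Fin 2 → M2) : ℝ :=
  (F (A 0) (B 0) (C 0)).re - (F (A 1) (B 1) (C 1)).re
    + ((F (A 0) (B 0) (C 1)).re + (F (A 0) (B 1) (C 0)).re + (F (A 1) (B 0) (C 0)).re)
    - ((F (A 0) (B 1) (C 1)).re + (F (A 1) (B 0) (C 1)).re + (F (A 1) (B 1) (C 0)).re)
    + ((F (A 0) (B 1) 1).re + (F (A 0) 1 (C 1)).re + (F 1 (B 0) (C 1)).re)
    + ((F (A 1) (B 0) 1).re + (F (A 1) 1 (C 0)).re + (F 1 (B 1) (C 0)).re)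

lemma bell_flip (F : Tri) (A B C : Fin 2 → M2) : bell F.flip B A C = bell F A B C := by
  simp only [bell, LinearMap.flip_apply]; ring

lemma bell_swapR (F : Tri) (A B C : Fin 2 → M2) : bell (swapR F) A C B = bell F A B C := by
  simp only [bell, swapR_apply]; ring

lemma isDichotomic_one : IsDichotomic 1 := ⟨Matrix.isHermitian_one, by simp⟩

lemma IsDichotomic.neg {A : M2} (h : IsDichotomic A) : IsDichotomic (-A) :=
  ⟨h.1.neg, by rw [neg_mul_neg, h.2]⟩

/-- In all correlators the observable `b` of the second party acts as a scalar `t ∈ [-1, 1]`. This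
is the case when `b = ±1`, and for every observable when the second qubit is in a pure state. -/
def Det₂ (F : Tri) (b : M2) : Prop :=
  ∃ t : ℝ, -1 ≤ t ∧ t ≤ 1 ∧ ∀ x z, F x b z = t * F x 1 z

/-- The analogue of `Det₂` for an observable of the third party. -/
def Det₃ (F : Tri) (c : M2) : Prop :=
  ∃ t : ℝ, -1 ≤ t ∧ t ≤ 1 ∧ ∀ x y, F x y c = t * F x y 1

lemma affine_le {a b t K : ℝ} (h1 : a + b ≤ K) (h2 : a - b ≤ K) (ht : -1 ≤ t) (ht' : t ≤ 1) :
    a + b * t ≤ K := by nlinarith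

/-- The moments of three commuting `±1`-valued observables, one for each party, are those of a
probability distribution on the eight triples of outcomes: its eight values are nonnegative. -/
lemma IsState.octant {F : Tri} (hF : IsState F) {a b c : M2} (ha : IsDichotomic a)
    (hb : IsDichotomic b) (hc : IsDichotomic c) :
    0 ≤ 1 + (F a 1 1).re + (F 1 b 1).re + (F 1 1 c).re + (F a b 1).re
        + (F a 1 c).re + (F 1 b c).re + (F a b c).re ∧
    0 ≤ 1 + (F a 1 1).re + (F 1 b 1).re - (F 1 1 c).re + (F a b 1).re
        - (F a 1 c).re - (F 1 b c).re - (F a b c).re ∧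
    0 ≤ 1 + (F a 1 1).re - (F 1 b 1).re + (F 1 1 c).re - (F a b 1).re
        + (F a 1 c).re - (F 1 b c).re - (F a b c).re ∧
    0 ≤ 1 + (F a 1 1).re - (F 1 b 1).re - (F 1 1 c).re - (F a b 1).re
        - (F a 1 c).re + (F 1 b c).re + (F a b c).re ∧
    0 ≤ 1 - (F a 1 1).re + (F 1 b 1).re + (F 1 1 c).re - (F a b 1).re
        - (F a 1 c).re + (F 1 b c).re - (F a b c).re ∧
    0 ≤ 1 - (F a 1 1).re + (F 1 b 1).re - (F 1 1 c).re - (F a b 1).re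
        + (F a 1 c).re - (F 1 b c).re + (F a b c).re ∧
    0 ≤ 1 - (F a 1 1).re - (F 1 b 1).re + (F 1 1 c).re + (F a b 1).re
        - (F a 1 c).re - (F 1 b c).re + (F a b c).re ∧
    0 ≤ 1 - (F a 1 1).re - (F 1 b 1).re - (F 1 1 c).re + (F a b 1).re
        + (F a 1 c).re + (F 1 b c).re - (F a b c).re := by
  have key : ∀ {a b c : M2}, IsDichotomic a → IsDichotomic b → IsDichotomic c →
      0 ≤ 1 + (F a 1 1).re + (F 1 b 1).re + (F 1 1 c).re + (F a b 1).re
        + (F a 1 c).re + (F 1 b c).re + (F a b c).re := by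
    intro a b c ha hb hc
    have h := hF.nonneg a b c ha hb hc
    simp only [map_add, LinearMap.add_apply, hF.norm, Complex.add_re, Complex.one_re] at h
    linarith
  have h2 := key ha hb hc.neg
  have h3 := key ha hb.neg hc
  have h4 := key ha hb.neg hc.neg
  have h5 := key ha.neg hb hc
  have h6 := key ha.neg hb hc.neg
  have h7 := key ha.neg hb.neg hc
  have h8 := key ha.neg hb.neg hc.neg
  simp only [map_neg, LinearMap.neg_apply, Complex.neg_re] at h2 h3 h4 h5 h6 h7 h8
  refine ⟨key ha hb hc, ?_, ?_, ?_, ?_, ?_, ?_, ?_⟩ <;> linarith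

lemma bilinear_le {k a b c t u K : ℝ} (h : ∀ t u : ℝ, (t = 1 ∨ t = -1) → (u = 1 ∨ u = -1) →
    k + a * t + b * u + c * (t * u) ≤ K) (ht : -1 ≤ t) (ht' : t ≤ 1) (hu : -1 ≤ u) (hu' : u ≤ 1) :
    k + a * t + b * u + c * (t * u) ≤ K := by
  have l : (1 : ℝ) = 1 ∨ (1 : ℝ) = -1 := Or.inl rfl
  have l' : (-1 : ℝ) = 1 ∨ (-1 : ℝ) = -1 := Or.inr rfl
  have h1 := affine_le (a := k + b * u) (b := a + c * u) (t := t) (K := K) ?_ ?_ ht ht'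
  · linarith
  · have := affine_le (a := k + a) (b := b + c) (t := u) (K := K)
      (by linarith [h 1 1 l l]) (by linarith [h 1 (-1) l l']) hu hu'
    linarith
  · have := affine_le (a := k - a) (b := b - c) (t := u) (K := K)
      (by linarith [h (-1) 1 l' l]) (by linarith [h (-1) (-1) l' l']) hu hu'
    linarith

/-- If two parties have one scalar observable each, then only their other observables matter; these
two and each observable of the remaining party are jointly measurable, which yields a local hidden
variable model, for which the bound is the classical one. In the proof the two scalars are moved to
`±1`, and the positivity of the joint distributions then gives the bound by linear arithmetic. -/
lemma bell_le_of_det {F : Tri} (hF : IsState F) {A B C : Fin 2 → M2}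
    (hA : ∀ i, IsDichotomic (A i)) (hB : ∀ i, IsDichotomic (B i)) (hC : ∀ i, IsDichotomic (C i))
    {j k : Fin 2} (hj : Det₂ F (B j)) (hk : Det₃ F (C k)) : bell F A B C ≤ 6 := by
  obtain ⟨t, ht, ht', hT⟩ := hj
  obtain ⟨u, hu, hu', hU⟩ := hk
  match j, k, hT, hU with
  | 0, 0, hT, hU =>
    have o0 := hF.octant (hA 0) (hB 1) (hC 1)
    have o1 := hF.octant (hA 1) (hB 1) (hC 1)
    simp only [bell, hT, hU, Complex.re_ofReal_mul]
    generalize (F (A 0) 1 1).re = a0 at *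
    generalize (F (A 1) 1 1).re = a1 at *
    refine le_trans (le_of_eq ?_) (bilinear_le (t := t) (u := u) (K := 6)
      (k := - (F (A 1) (B 1) (C 1)).re - (F (A 0) (B 1) (C 1)).re + (F (A 0) (B 1) 1).re
        + (F (A 0) 1 (C 1)).re)
      (a := (F (A 0) 1 (C 1)).re - (F (A 1) 1 (C 1)).re + (F 1 1 (C 1)).re + a1)
      (b := (F (A 0) (B 1) 1).re - (F (A 1) (B 1) 1).re + (F 1 (B 1) 1).re + a1)
      (c := a0 + a1) ?_ ht ht' hu hu')
    · ring
    · rintro t u (rfl | rfl) (rfl | rfl) <;> linarith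
  | 0, 1, hT, hU =>
    have o0 := hF.octant (hA 0) (hB 1) (hC 0)
    have o1 := hF.octant (hA 1) (hB 1) (hC 0)
    simp only [bell, hT, hU, hF.norm, Complex.re_ofReal_mul, Complex.one_re]
    generalize (F (A 0) 1 1).re = a0 at *
    generalize (F (A 1) 1 1).re = a1 at *
    refine le_trans (le_of_eq ?_) (bilinear_le (t := t) (u := u) (K := 6)
      (k := (F (A 0) (B 1) (C 0)).re - (F (A 1) (B 1) (C 0)).re + (F (A 0) (B 1) 1).re
        + (F (A 1) 1 (C 0)).re + (F 1 (B 1) (C 0)).re)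
      (a := (F (A 0) 1 (C 0)).re + (F (A 1) 1 (C 0)).re + a1)
      (b := - (F (A 1) (B 1) 1).re - (F (A 0) (B 1) 1).re + a0)
      (c := a0 - a1 + 1) ?_ ht ht' hu hu')
    · ring
    · rintro t u (rfl | rfl) (rfl | rfl) <;> linarith
  | 1, 0, hT, hU =>
    have o0 := hF.octant (hA 0) (hB 0) (hC 1)
    have o1 := hF.octant (hA 1) (hB 0) (hC 1)
    simp only [bell, hT, hU, hF.norm, Complex.re_ofReal_mul, Complex.one_re]
    generalize (F (A 0) 1 1).re = a0 at *
    generalize (F (A 1) 1 1).re = a1 at *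
    refine le_trans (le_of_eq ?_) (bilinear_le (t := t) (u := u) (K := 6)
      (k := (F (A 0) (B 0) (C 1)).re - (F (A 1) (B 0) (C 1)).re + (F (A 1) (B 0) 1).re
        + (F (A 0) 1 (C 1)).re + (F 1 (B 0) (C 1)).re)
      (a := - (F (A 1) 1 (C 1)).re - (F (A 0) 1 (C 1)).re + a0)
      (b := (F (A 0) (B 0) 1).re + (F (A 1) (B 0) 1).re + a1)
      (c := a0 - a1 + 1) ?_ ht ht' hu hu')
    · ring
    · rintro t u (rfl | rfl) (rfl | rfl) <;> linarith
  | 1, 1, hT, hU =>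
    have o0 := hF.octant (hA 0) (hB 0) (hC 0)
    have o1 := hF.octant (hA 1) (hB 0) (hC 0)
    simp only [bell, hT, hU, Complex.re_ofReal_mul]
    generalize (F (A 0) 1 1).re = a0 at *
    generalize (F (A 1) 1 1).re = a1 at *
    refine le_trans (le_of_eq ?_) (bilinear_le (t := t) (u := u) (K := 6)
      (k := (F (A 0) (B 0) (C 0)).re + (F (A 1) (B 0) (C 0)).re + (F (A 1) (B 0) 1).re
        + (F (A 1) 1 (C 0)).re)
      (a := (F (A 0) 1 (C 0)).re - (F (A 1) 1 (C 0)).re + (F 1 1 (C 0)).re + a0)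
      (b := (F (A 0) (B 0) 1).re - (F (A 1) (B 0) 1).re + (F 1 (B 0) 1).re + a0)
      (c := - a0 - a1) ?_ ht ht' hu hu')
    · ring
    · rintro t u (rfl | rfl) (rfl | rfl) <;> linarith

/-- If the observables of the third party are scalars and all the marginals of the first two vanish,
then `bell` is a combination of four correlators in `[-1, 1]` whose coefficients, for scalars `±1`,
have absolute values summing to `6`. -/
lemma bell_le_of_marginals {F : Tri} (hF : IsState F) {A B C : Fin 2 → M2}
    (hA : ∀ i, IsDichotomic (A i)) (hB : ∀ i, IsDichotomic (B i))
    (hA0 : ∀ i, F (A i) 1 1 = 0) (hB0 : ∀ j, F 1 (B j) 1 = 0)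
    (hC : ∀ k, Det₃ F (C k)) : bell F A B C ≤ 6 := by
  obtain ⟨t, ht, ht', hT⟩ := hC 0
  obtain ⟨u, hu, hu', hU⟩ := hC 1
  have e : ∀ i j, -1 ≤ (F (A i) (B j) 1).re ∧ (F (A i) (B j) 1).re ≤ 1 := by
    intro i j
    have h := hF.octant (hA i) (hB j) isDichotomic_one
    simp only [hA0, hB0, hF.norm, Complex.zero_re, Complex.one_re] at h
    constructor <;> linarith
  have e00 := e 0 0
  have e01 := e 0 1
  have e10 := e 1 0
  have e11 := e 1 1
  simp only [bell, hT, hU, hA0, hB0, Complex.re_ofReal_mul, Complex.zero_re]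
  generalize (F (A 0) (B 0) 1).re = E00 at *
  generalize (F (A 0) (B 1) 1).re = E01 at *
  generalize (F (A 1) (B 0) 1).re = E10 at *
  generalize (F (A 1) (B 1) 1).re = E11 at *
  refine le_trans (le_of_eq ?_) (bilinear_le (t := t) (u := u) (K := 6)
      (k := E01 + E10) (a := E00 + E01 + E10 - E11) (b := E00 - E11 - E01 - E10)
      (c := 0) ?_ ht ht' hu hu')
  · ring
  · rintro t u (rfl | rfl) (rfl | rfl) <;> linarith

/-! ### Real inequalities -/

/-- For complex numbers `a, b, c, d`, given by real and imaginary parts,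
`|a (c - d) - b (c + d)|² ≤ 2 (|a|² + |b|²) (|c|² + |d|²)`. -/
lemma chsh_sq_le (a a' b b' c c' d d' : ℝ) :
    (a * c - a' * c' - b * d + b' * d' - a * d + a' * d' - b * c + b' * c') ^ 2
      + (a * c' + a' * c - b * d' - b' * d - a * d' - a' * d - b * c' - b' * c) ^ 2
      ≤ 2 * (a ^ 2 + a' ^ 2 + b ^ 2 + b' ^ 2) * (c ^ 2 + c' ^ 2 + d ^ 2 + d' ^ 2) := by
  -- Lagrange's identity for the Cauchy-Schwarz inequality, and the parallelogram law for `c`, `d`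
  have h1 := sq_nonneg (a * (c + d) + a' * (c' + d') + b * (c - d) + b' * (c' - d'))
  have h2 := sq_nonneg (a' * (c + d) - a * (c' + d') + b' * (c - d) - b * (c' - d'))
  linarith

lemma box_quadratic_le {p q s t : ℝ} (hp : p ^ 2 ≤ 1) (hq : q ^ 2 ≤ 1) (hs : s ^ 2 ≤ 1)
    (ht : t ^ 2 ≤ 1) :
    3 - (p ^ 2 + q ^ 2) / 4 - (s + t) ^ 2 / 2 + 3 * (p * q) / 2 + 2 * (p * t) + 2 * (q * s)
      ≤ 6 := by
  nlinarith [sq_nonneg (p - q), sq_nonneg (s + t - p - q), sq_nonneg (p - q - t + s),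
    sq_nonneg (s - t)]

/-- The bound for a GHZ state when exactly one observable is `±1`, called `ε` here. The vector
`(x, y, z)` is the partner of that observable; `p, s` and `q, t` are the third coordinates of the
observables of the other two parties, and `u + iv` is what multiplies `x + iy`. -/
lemma one_det_real_le {p q s t x y z u v ε : ℝ} (hp : p ^ 2 ≤ 1) (hq : q ^ 2 ≤ 1) (hs : s ^ 2 ≤ 1)
    (ht : t ^ 2 ≤ 1) (hn : x ^ 2 + y ^ 2 + z ^ 2 = 1) (hε : ε = 1 ∨ ε = -1)
    (huv : u ^ 2 + v ^ 2 ≤ 2 * (2 - p ^ 2 - s ^ 2) * (2 - q ^ 2 - t ^ 2)) :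
    x * u - y * v + z * (p + q) + ε * (p * q + p * t + s * q - s * t) + p * t + s * q ≤ 6 := by
  -- `m ⬝ w ≤ |m|² + |w|² / 4` is sharp at `|w| = 2`, its value at the extremal point
  -- `p = q = s = t = 1`, `u = v = 0`
  have h1 : x * u - y * v + z * (p + q) ≤ 1 + (u ^ 2 + v ^ 2) / 4 + (p + q) ^ 2 / 4 := by
    nlinarith [sq_nonneg (2 * x - u), sq_nonneg (2 * y + v), sq_nonneg (2 * z - (p + q))]
  have h2 : (2 - p ^ 2 - s ^ 2) * (2 - q ^ 2 - t ^ 2) ≤ 4 - p ^ 2 - s ^ 2 - q ^ 2 - t ^ 2 := by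
    have e1 : 0 ≤ (2 - p ^ 2 - s ^ 2) * (q ^ 2 + t ^ 2) := by
      apply mul_nonneg <;> nlinarith
    have e2 : 0 ≤ (2 - q ^ 2 - t ^ 2) * (p ^ 2 + s ^ 2) := by
      apply mul_nonneg <;> nlinarith
    linarith
  rcases hε with rfl | rfl
  · linarith [box_quadratic_le hp hq hs ht]
  · nlinarith [sq_nonneg (p + q), sq_nonneg (s - t)]

lemma cauchy_four (e e' f f' P P' Q Q' : ℝ) : (e * P - e' * P' + f * Q - f' * Q') ^ 2 ≤
    (e ^ 2 + e' ^ 2 + f ^ 2 + f' ^ 2) * (P ^ 2 + P' ^ 2 + Q ^ 2 + Q' ^ 2) := by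
  linarith [sq_nonneg (e * P' + e' * P), sq_nonneg (e * Q - f * P), sq_nonneg (e * Q' + f' * P),
    sq_nonneg (e' * Q + f * P'), sq_nonneg (e' * Q' - f' * P'), sq_nonneg (f * Q' + f' * Q)]

lemma four_mul_prod_le {α β γ : ℝ} (α0 : 0 ≤ α) (β0 : 0 ≤ β) (γ0 : 0 ≤ γ) (α2 : α ≤ 2)
    (β2 : β ≤ 2) (γ2 : γ ≤ 2) : 4 * (α * β * γ) ≤ (α + β + γ) ^ 2 := by
  have e1 : 0 ≤ α * β * (2 - γ) := mul_nonneg (mul_nonneg α0 β0) (by linarith)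
  have e2 : 0 ≤ β * γ * (2 - α) := mul_nonneg (mul_nonneg β0 γ0) (by linarith)
  have e3 : 0 ≤ γ * α * (2 - β) := mul_nonneg (mul_nonneg γ0 α0) (by linarith)
  have e4 : 0 ≤ α * β * γ := by positivity
  linarith [sq_nonneg (α - β), sq_nonneg (β - γ), sq_nonneg (γ - α)]

/-- The bound for a GHZ state with no scalar observable: the Svetlichny expression of six complex
numbers of modulus at most `1` is at most the sum of their squared moduli. With `P` and `Q` the
factors of the third party's numbers, `|P|²` and `|Q|²` are at most `2αβ`, hence the square of the
expression is at most `4αβγ`, where `α, β, γ ≤ 2` are the sums of squared moduli for the parties. -/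
lemma svetlichny_le {a a' b b' c c' d d' e e' f f' : ℝ}
    (ha : a ^ 2 + a' ^ 2 ≤ 1) (hb : b ^ 2 + b' ^ 2 ≤ 1) (hc : c ^ 2 + c' ^ 2 ≤ 1)
    (hd : d ^ 2 + d' ^ 2 ≤ 1) (he : e ^ 2 + e' ^ 2 ≤ 1) (hf : f ^ 2 + f' ^ 2 ≤ 1) :
    e * (a * c - a' * c' - b * d + b' * d' + a * d - a' * d' + b * c - b' * c')
      - e' * (a * c' + a' * c - b * d' - b' * d + a * d' + a' * d + b * c' + b' * c)
      + f * (a * c - a' * c' - b * d + b' * d' - a * d + a' * d' - b * c + b' * c')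
      - f' * (a * c' + a' * c - b * d' - b' * d - a * d' - a' * d - b * c' - b' * c)
      ≤ (a ^ 2 + a' ^ 2 + b ^ 2 + b' ^ 2) + (c ^ 2 + c' ^ 2 + d ^ 2 + d' ^ 2)
        + (e ^ 2 + e' ^ 2 + f ^ 2 + f' ^ 2) := by
  have hQ := chsh_sq_le a a' b b' c c' d d'
  have hP := chsh_sq_le a a' (-b) (-b') c c' (-d) (-d')
  set P := a * c - a' * c' - b * d + b' * d' + a * d - a' * d' + b * c - b' * c' with hPd
  set P' := a * c' + a' * c - b * d' - b' * d + a * d' + a' * d + b * c' + b' * c with hPd'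
  set Q := a * c - a' * c' - b * d + b' * d' - a * d + a' * d' - b * c + b' * c' with hQd
  set Q' := a * c' + a' * c - b * d' - b' * d - a * d' - a' * d - b * c' - b' * c with hQd'
  have hP2 : P ^ 2 + P' ^ 2 ≤
      2 * (a ^ 2 + a' ^ 2 + b ^ 2 + b' ^ 2) * (c ^ 2 + c' ^ 2 + d ^ 2 + d' ^ 2) := by
    refine le_trans (le_of_eq ?_) (hP.trans (le_of_eq ?_)) <;> (try simp only [hPd, hPd']) <;> ring
  clear hP hPd hPd' hQd hQd'
  clear_value P P' Q Q'
  obtain ⟨α, hα⟩ : ∃ α, α = a ^ 2 + a' ^ 2 + b ^ 2 + b' ^ 2 := ⟨_, rfl⟩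
  obtain ⟨β, hβ⟩ : ∃ β, β = c ^ 2 + c' ^ 2 + d ^ 2 + d' ^ 2 := ⟨_, rfl⟩
  obtain ⟨γ, hγ⟩ : ∃ γ, γ = e ^ 2 + e' ^ 2 + f ^ 2 + f' ^ 2 := ⟨_, rfl⟩
  rw [← hα, ← hβ] at hQ hP2
  rw [← hα, ← hβ, ← hγ]
  have α0 : 0 ≤ α := by rw [hα]; positivity
  have β0 : 0 ≤ β := by rw [hβ]; positivity
  have γ0 : 0 ≤ γ := by rw [hγ]; positivity
  have α2 : α ≤ 2 := by linarith
  have β2 : β ≤ 2 := by linarith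
  have γ2 : γ ≤ 2 := by linarith
  have cs : (e * P - e' * P' + f * Q - f' * Q') ^ 2 ≤ γ * (P ^ 2 + P' ^ 2 + Q ^ 2 + Q' ^ 2) := by
    rw [hγ]; exact cauchy_four e e' f f' P P' Q Q'
  have h1 : γ * (P ^ 2 + P' ^ 2 + Q ^ 2 + Q' ^ 2) ≤ γ * (4 * α * β) := by
    apply mul_le_mul_of_nonneg_left _ γ0; linarith
  have h2 := four_mul_prod_le α0 β0 γ0 α2 β2 γ2
  refine le_trans (le_of_eq ?_) (abs_le_of_sq_le_sq' (cs.trans (h1.trans ?_)) (by positivity)).2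
  · ring
  · linarith

/-! ### Stabilizers and GHZ states -/

/-- The product operator `a ⊗ b ⊗ c` acts from either side as the scalar `ε` on the state that the
form `F` describes. -/
def Stab (F : Tri) (a b c : M2) (ε : ℂ) : Prop :=
  ∀ x y z, F (a * x) (b * y) (c * z) = ε * F x y z ∧ F (x * a) (y * b) (z * c) = ε * F x y z

lemma Stab.flip {F : Tri} {a b c : M2} {ε : ℂ} (h : Stab F a b c ε) : Stab F.flip b a c ε :=
  fun x y z => h y x z

lemma Stab.swapR {F : Tri} {a b c : M2} {ε : ℂ} (h : Stab F a b c ε) : Stab (swapR F) a c b ε :=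
  fun x y z => h x z y

lemma Stab.mul {F : Tri} {a b c a' b' c' : M2} {ε ε' : ℂ} (h : Stab F a b c ε)
    (h' : Stab F a' b' c' ε') : Stab F (a * a') (b * b') (c * c') (ε * ε') := by
  intro x y z
  constructor
  · rw [mul_assoc, mul_assoc, mul_assoc, (h _ _ _).1, (h' _ _ _).1, mul_assoc]
  · rw [← mul_assoc, ← mul_assoc, ← mul_assoc, (h' _ _ _).2, (h _ _ _).2]; ring

lemma Stab.smul {F : Tri} {a b c : M2} {ε : ℂ} (h : Stab F a b c ε) (u v w : ℂ) :
    Stab F (u • a) (v • b) (w • c) (u * v * w * ε) := by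
  intro x y z
  simp only [smul_mul_assoc, mul_smul_comm, map_smul, LinearMap.smul_apply, smul_eq_mul,
    (h x y z).1, (h x y z).2]
  constructor <;> ring

/-- An operator that anticommutes with a stabilizer has expectation value zero. -/
lemma Stab.eq_zero {F : Tri} {a b c : M2} {ε : ℂ} (h : Stab F a b c ε) (hε : ε ≠ 0)
    {x y z : M2} (r s t : ℂ) (hx : a * x = r • (x * a)) (hy : b * y = s • (y * b))
    (hz : c * z = t • (z * c)) (hrst : r * s * t = -1) : F x y z = 0 := by
  have h1 := (h x y z).1
  rw [hx, hy, hz] at h1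
  simp only [map_smul, LinearMap.smul_apply, smul_eq_mul, (h x y z).2] at h1
  have h2 : ε * F x y z * (r * s * t - 1) = 0 := by linear_combination h1
  rw [hrst] at h2
  have : ε * F x y z = 0 := by
    rcases mul_eq_zero.1 h2 with h | h
    · exact h
    · norm_num at h
  exact (mul_eq_zero.1 this).resolve_left hε

/-- The operator with Bloch vector `(x, y, z)` in the frame `X, Y, Z` with `Y = iXZ`. -/
def frameVec (X Z : M2) (x y z : ℝ) : M2 :=
  (x : ℂ) • X + (y : ℂ) • (I • (X * Z)) + (z : ℂ) • Z

/-- `X` and `Z` are anticommuting involutions and, with `Y = iXZ`, every dichotomic observable is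
`±1` or has a real unit Bloch vector with respect to `X, Y, Z`. -/
structure IsFrame (X Z : M2) : Prop where
  X_sq : X * X = 1
  Z_sq : Z * Z = 1
  anti : Z * X = -(X * Z)
  coord : ∀ A, IsDichotomic A → (A = 1 ∨ A = -1) ∨
    ∃ x y z : ℝ, x ^ 2 + y ^ 2 + z ^ 2 = 1 ∧ A = frameVec X Z x y z

lemma IsFrame.Z_mul_Y {X Z : M2} (h : IsFrame X Z) : Z * (X * Z) = (-1 : ℂ) • (X * Z * Z) := by
  rw [← mul_assoc, h.anti]; simp

lemma IsFrame.Z_mul_X {X Z : M2} (h : IsFrame X Z) : Z * X = (-1 : ℂ) • (X * Z) := by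
  rw [h.anti]; simp

lemma IsFrame.X_mul_Z {X Z : M2} (h : IsFrame X Z) : X * Z = (-1 : ℂ) • (Z * X) := by
  rw [h.anti]; simp

lemma IsFrame.X_mul_Y {X Z : M2} (h : IsFrame X Z) : X * (X * Z) = (-1 : ℂ) • (X * Z * X) := by
  rw [mul_assoc, h.anti]; simp

lemma comm_self (a : M2) : a * a = (1 : ℂ) • (a * a) := (one_smul _ _).symm
lemma comm_one (a : M2) : a * 1 = (1 : ℂ) • (1 * a) := by simp
lemma one_comm (a : M2) : 1 * a = (1 : ℂ) • (a * 1) := by simp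

/-- The form `F` describes a state stabilized by `XXX`, `ZZ1`, `Z1Z` and `1ZZ` for suitable local
frames, that is, a GHZ state up to local unitaries. -/
structure IsGHZ (F : Tri) (X₁ Z₁ X₂ Z₂ X₃ Z₃ : M2) : Prop where
  frame₁ : IsFrame X₁ Z₁
  frame₂ : IsFrame X₂ Z₂
  frame₃ : IsFrame X₃ Z₃
  norm : F 1 1 1 = 1
  sX : Stab F X₁ X₂ X₃ 1
  s12 : Stab F Z₁ Z₂ 1 1
  s13 : Stab F Z₁ 1 Z₃ 1
  s23 : Stab F 1 Z₂ Z₃ 1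

namespace IsGHZ
variable {F : Tri} {X₁ Z₁ X₂ Z₂ X₃ Z₃ : M2}

lemma flip (h : IsGHZ F X₁ Z₁ X₂ Z₂ X₃ Z₃) : IsGHZ F.flip X₂ Z₂ X₁ Z₁ X₃ Z₃ :=
  ⟨h.frame₂, h.frame₁, h.frame₃, h.norm, h.sX.flip, h.s12.flip, h.s23.flip, h.s13.flip⟩

lemma swapR (h : IsGHZ F X₁ Z₁ X₂ Z₂ X₃ Z₃) : IsGHZ (swapR F) X₁ Z₁ X₃ Z₃ X₂ Z₂ :=
  ⟨h.frame₁, h.frame₃, h.frame₂, h.norm, h.sX.swapR, h.s13.swapR, h.s12.swapR, h.s23.swapR⟩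

/-- Only `XXX`, `XYY`, `YXY`, `YYX` have nonzero expectation values among the products of three of
`X, Y, Z`: every other one anticommutes with a stabilizer. -/
lemma corr3 (h : IsGHZ F X₁ Z₁ X₂ Z₂ X₃ Z₃) (x y z x' y' z' x'' y'' z'' : ℝ) :
    F (frameVec X₁ Z₁ x y z) (frameVec X₂ Z₂ x' y' z') (frameVec X₃ Z₃ x'' y'' z'') =
      ((x * x' * x'' - x * y' * y'' - y * x' * y'' - y * y' * x'' : ℝ) : ℂ) := by
  obtain ⟨f1, f2, f3, hn, sX, s12, s13, s23⟩ := h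
  have n1 : (1 : ℂ) ≠ 0 := one_ne_zero
  have e1 : F X₁ X₂ X₃ = 1 := by have := (sX 1 1 1).1; simpa [hn] using this
  have z23 : F 1 Z₂ Z₃ = 1 := by have := (s23 1 1 1).1; simpa [hn] using this
  have z13 : F Z₁ 1 Z₃ = 1 := by have := (s13 1 1 1).1; simpa [hn] using this
  have z12 : F Z₁ Z₂ 1 = 1 := by have := (s12 1 1 1).1; simpa [hn] using this
  have e2 : F X₁ (X₂ * Z₂) (X₃ * Z₃) = 1 := by have := (sX 1 Z₂ Z₃).1; simpa [z23] using this
  have e3 : F (X₁ * Z₁) X₂ (X₃ * Z₃) = 1 := by have := (sX Z₁ 1 Z₃).1; simpa [z13] using this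
  have e4 : F (X₁ * Z₁) (X₂ * Z₂) X₃ = 1 := by have := (sX Z₁ Z₂ 1).1; simpa [z12] using this
  have o1 : F (X₁ * Z₁) X₂ X₃ = 0 :=
    sX.eq_zero n1 (-1) 1 1 f1.X_mul_Y (comm_self _) (comm_self _) (by norm_num)
  have o2 : F X₁ (X₂ * Z₂) X₃ = 0 :=
    sX.eq_zero n1 1 (-1) 1 (comm_self _) f2.X_mul_Y (comm_self _) (by norm_num)
  have o3 : F X₁ X₂ (X₃ * Z₃) = 0 :=
    sX.eq_zero n1 1 1 (-1) (comm_self _) (comm_self _) f3.X_mul_Y (by norm_num)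
  have o4 : F (X₁ * Z₁) (X₂ * Z₂) (X₃ * Z₃) = 0 :=
    sX.eq_zero n1 (-1) (-1) (-1) f1.X_mul_Y f2.X_mul_Y f3.X_mul_Y (by norm_num)
  have zzz : F Z₁ Z₂ Z₃ = 0 :=
    sX.eq_zero n1 (-1) (-1) (-1) f1.X_mul_Z f2.X_mul_Z f3.X_mul_Z (by norm_num)
  have a1 : ∀ M, F Z₁ X₂ M = 0 := fun M =>
    (s12.eq_zero n1 1 (-1) 1 (comm_self _) f2.Z_mul_X (one_comm _) (by norm_num))
  have a2 : ∀ M, F Z₁ (X₂ * Z₂) M = 0 := fun M =>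
    (s12.eq_zero n1 1 (-1) 1 (comm_self _) f2.Z_mul_Y (one_comm _) (by norm_num))
  have a3 : ∀ M, F X₁ Z₂ M = 0 := fun M =>
    (s12.eq_zero n1 (-1) 1 1 f1.Z_mul_X (comm_self _) (one_comm _) (by norm_num))
  have a4 : ∀ M, F (X₁ * Z₁) Z₂ M = 0 := fun M =>
    (s12.eq_zero n1 (-1) 1 1 f1.Z_mul_Y (comm_self _) (one_comm _) (by norm_num))
  have a5 : ∀ M, F X₁ M Z₃ = 0 := fun M =>
    (s13.eq_zero n1 (-1) 1 1 f1.Z_mul_X (one_comm _) (comm_self _) (by norm_num))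
  have a6 : ∀ M, F (X₁ * Z₁) M Z₃ = 0 := fun M =>
    (s13.eq_zero n1 (-1) 1 1 f1.Z_mul_Y (one_comm _) (comm_self _) (by norm_num))
  have a7 : ∀ M, F Z₁ M X₃ = 0 := fun M =>
    (s13.eq_zero n1 1 1 (-1) (comm_self _) (one_comm _) f3.Z_mul_X (by norm_num))
  have a8 : ∀ M, F Z₁ M (X₃ * Z₃) = 0 := fun M =>
    (s13.eq_zero n1 1 1 (-1) (comm_self _) (one_comm _) f3.Z_mul_Y (by norm_num))
  simp only [frameVec, map_add, map_smul, LinearMap.add_apply, LinearMap.smul_apply, smul_eq_mul,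
    e1, e2, e3, e4, o1, o2, o3, o4, zzz, a1, a2, a3, a4, a5, a6, a7, a8]
  push_cast
  linear_combination (x * y' * y'' + y * x' * y'' + y * y' * x'' : ℂ) * Complex.I_sq

lemma corr12 (h : IsGHZ F X₁ Z₁ X₂ Z₂ X₃ Z₃) (x y z x' y' z' : ℝ) :
    F (frameVec X₁ Z₁ x y z) (frameVec X₂ Z₂ x' y' z') 1 = ((z * z' : ℝ) : ℂ) := by
  obtain ⟨f1, f2, f3, hn, sX, s12, s13, s23⟩ := h
  have n1 : (1 : ℂ) ≠ 0 := one_ne_zero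
  have z12 : F Z₁ Z₂ 1 = 1 := by have := (s12 1 1 1).1; simpa [hn] using this
  have b1 : ∀ M, F X₁ M 1 = 0 := fun M =>
    (s13.eq_zero n1 (-1) 1 1 f1.Z_mul_X (one_comm _) (comm_one _) (by norm_num))
  have b2 : ∀ M, F (X₁ * Z₁) M 1 = 0 := fun M =>
    (s13.eq_zero n1 (-1) 1 1 f1.Z_mul_Y (one_comm _) (comm_one _) (by norm_num))
  have b3 : ∀ M, F M X₂ 1 = 0 := fun M =>
    (s23.eq_zero n1 1 (-1) 1 (one_comm _) f2.Z_mul_X (comm_one _) (by norm_num))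
  have b4 : ∀ M, F M (X₂ * Z₂) 1 = 0 := fun M =>
    (s23.eq_zero n1 1 (-1) 1 (one_comm _) f2.Z_mul_Y (comm_one _) (by norm_num))
  simp only [frameVec, map_add, map_smul, LinearMap.add_apply, LinearMap.smul_apply, smul_eq_mul,
    z12, b1, b2, b3, b4]
  push_cast; ring

lemma corr1 (h : IsGHZ F X₁ Z₁ X₂ Z₂ X₃ Z₃) (x y z : ℝ) :
    F (frameVec X₁ Z₁ x y z) 1 1 = 0 := by
  obtain ⟨f1, f2, f3, hn, sX, s12, s13, s23⟩ := h
  have n1 : (1 : ℂ) ≠ 0 := one_ne_zero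
  have b1 : F X₁ 1 1 = 0 :=
    (s13.eq_zero n1 (-1) 1 1 f1.Z_mul_X (one_comm _) (comm_one _) (by norm_num))
  have b2 : F (X₁ * Z₁) 1 1 = 0 :=
    (s13.eq_zero n1 (-1) 1 1 f1.Z_mul_Y (one_comm _) (comm_one _) (by norm_num))
  have b3 : F Z₁ 1 1 = 0 :=
    (sX.eq_zero n1 (-1) 1 1 f1.X_mul_Z (comm_one _) (comm_one _) (by norm_num))
  simp only [frameVec, map_add, map_smul, LinearMap.add_apply, LinearMap.smul_apply, smul_eq_mul,
    b1, b2, b3]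
  ring

lemma corr13 (h : IsGHZ F X₁ Z₁ X₂ Z₂ X₃ Z₃) (x y z x' y' z' : ℝ) :
    F (frameVec X₁ Z₁ x y z) 1 (frameVec X₃ Z₃ x' y' z') = ((z * z' : ℝ) : ℂ) :=
  h.swapR.corr12 x y z x' y' z'

lemma corr23 (h : IsGHZ F X₁ Z₁ X₂ Z₂ X₃ Z₃) (x y z x' y' z' : ℝ) :
    F 1 (frameVec X₂ Z₂ x y z) (frameVec X₃ Z₃ x' y' z') = ((z * z' : ℝ) : ℂ) :=
  h.flip.swapR.corr12 x y z x' y' z'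

lemma corr2 (h : IsGHZ F X₁ Z₁ X₂ Z₂ X₃ Z₃) (x y z : ℝ) :
    F 1 (frameVec X₂ Z₂ x y z) 1 = 0 := h.flip.corr1 x y z

end IsGHZ

lemma exists_sign {A : M2} (h : A = 1 ∨ A = -1) : ∃ ε : ℝ, (ε = 1 ∨ ε = -1) ∧ A = (ε : ℂ) • 1 := by
  rcases h with rfl | rfl
  · exact ⟨1, Or.inl rfl, by simp⟩
  · exact ⟨-1, Or.inr rfl, by simp⟩

lemma Det₃.of_trivial (F : Tri) {A : M2} (h : A = 1 ∨ A = -1) : Det₃ F A := by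
  obtain ⟨ε, hε, rfl⟩ := exists_sign h
  refine ⟨ε, ?_, ?_, fun x y => by simp⟩ <;> rcases hε with rfl | rfl <;> norm_num

lemma Det₂.of_trivial (F : Tri) {A : M2} (h : A = 1 ∨ A = -1) : Det₂ F A := by
  obtain ⟨ε, hε, rfl⟩ := exists_sign h
  refine ⟨ε, ?_, ?_, fun x y => by simp⟩ <;> rcases hε with rfl | rfl <;> norm_num

/-- The bound for a GHZ state when the observables of two parties are not `±1`. -/
lemma IsGHZ.bell_le_of_nontrivial {F : Tri} (hF : IsState F) {X₁ Z₁ X₂ Z₂ X₃ Z₃ : M2}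
    (h : IsGHZ F X₁ Z₁ X₂ Z₂ X₃ Z₃) {A B C : Fin 2 → M2}
    (hA : ∀ i, IsDichotomic (A i)) (hB : ∀ i, IsDichotomic (B i)) (hC : ∀ i, IsDichotomic (C i))
    (hA' : ∀ i, ¬ (A i = 1 ∨ A i = -1)) (hB' : ∀ i, ¬ (B i = 1 ∨ B i = -1)) :
    bell F A B C ≤ 6 := by
  have cA := fun i => (h.frame₁.coord (A i) (hA i)).resolve_left (hA' i)
  have cB := fun i => (h.frame₂.coord (B i) (hB i)).resolve_left (hB' i)
  choose a a' p hap hAe using cA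
  choose b b' q hbq hBe using cB
  have bd : ∀ {x y z : ℝ}, x ^ 2 + y ^ 2 + z ^ 2 = 1 → z ^ 2 ≤ 1 := by intros; nlinarith
  have sqA : a 0 ^ 2 + a' 0 ^ 2 + a 1 ^ 2 + a' 1 ^ 2 = 2 - p 0 ^ 2 - p 1 ^ 2 := by
    linarith [hap 0, hap 1]
  have sqB : b 0 ^ 2 + b' 0 ^ 2 + b 1 ^ 2 + b' 1 ^ 2 = 2 - q 0 ^ 2 - q 1 ^ 2 := by
    linarith [hbq 0, hbq 1]
  rcases h.frame₃.coord _ (hC 0) with h0 | ⟨e, e', r, her, he⟩ <;>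
    rcases h.frame₃.coord _ (hC 1) with h1 | ⟨f, f', r', hfr, hf⟩
  · refine bell_le_of_marginals hF hA hB (fun i => ?_) (fun i => ?_)
      (Fin.forall_fin_two.2 ⟨Det₃.of_trivial F h0, Det₃.of_trivial F h1⟩)
    · rw [hAe, h.corr1]
    · rw [hBe, h.corr2]
  · obtain ⟨ε, hε, h0⟩ := exists_sign h0
    have key := one_det_real_le (bd (hap 0)) (bd (hbq 0)) (bd (hap 1)) (bd (hbq 1)) hfr hε
      (by rw [← sqA, ← sqB]; exact chsh_sq_le (a 0) (a' 0) (a 1) (a' 1) (b 0) (b' 0) (b 1) (b' 1))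
    simp only [bell, hAe, hBe, h0, hf, h.corr3, h.corr12, h.corr13, h.corr23, h.corr1, h.corr2,
      map_smul, smul_eq_mul, Complex.re_ofReal_mul, Complex.ofReal_re, mul_zero, Complex.zero_re]
    linarith
  · -- exchanging the two settings reduces this case to the previous one, with `ε` negated
    obtain ⟨ε, hε, h1⟩ := exists_sign h1
    have key := one_det_real_le (bd (hap 1)) (bd (hbq 1)) (bd (hap 0)) (bd (hbq 0)) her
      (ε := -ε) (by rcases hε with rfl | rfl <;> simp)
      ((chsh_sq_le (a 0) (a' 0) (-a 1) (-a' 1) (b 0) (b' 0) (-b 1) (-b' 1)).trans (le_of_eq (by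
        linear_combination 2 * (b 0 ^ 2 + b' 0 ^ 2 + b 1 ^ 2 + b' 1 ^ 2) * sqA
          + 2 * (2 - p 0 ^ 2 - p 1 ^ 2) * sqB)))
    simp only [bell, hAe, hBe, h1, he, h.corr3, h.corr12, h.corr13, h.corr23, h.corr1, h.corr2,
      map_smul, smul_eq_mul, Complex.re_ofReal_mul, Complex.ofReal_re, mul_zero, Complex.zero_re]
    linarith
  · simp only [bell, hAe, hBe, he, hf, h.corr3, h.corr12, h.corr13, h.corr23, Complex.ofReal_re]
    have key := svetlichny_le (a := a 0) (a' := a' 0) (b := a 1) (b' := a' 1)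
      (c := b 0) (c' := b' 0) (d := b 1) (d' := b' 1) (e := e) (e' := e') (f := f) (f' := f')
      (by linarith [hap 0, sq_nonneg (p 0)]) (by linarith [hap 1, sq_nonneg (p 1)])
      (by linarith [hbq 0, sq_nonneg (q 0)]) (by linarith [hbq 1, sq_nonneg (q 1)])
      (by linarith [sq_nonneg r]) (by linarith [sq_nonneg r'])
    have := hap 0
    have := hap 1
    have := hbq 0
    have := hbq 1
    -- the pairs in `R₂` form a hexagon on the six observables, and `2zz' ≤ z² + z'²` for each pair
    nlinarith [sq_nonneg (p 0 - q 1), sq_nonneg (p 1 - q 0), sq_nonneg (p 0 - r'),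
      sq_nonneg (p 1 - r), sq_nonneg (q 0 - r'), sq_nonneg (q 1 - r)]

lemma IsGHZ.bell_le {F : Tri} (hF : IsState F) {X₁ Z₁ X₂ Z₂ X₃ Z₃ : M2}
    (h : IsGHZ F X₁ Z₁ X₂ Z₂ X₃ Z₃) {A B C : Fin 2 → M2}
    (hA : ∀ i, IsDichotomic (A i)) (hB : ∀ i, IsDichotomic (B i)) (hC : ∀ i, IsDichotomic (C i)) :
    bell F A B C ≤ 6 := by
  by_cases tA : ∃ i, A i = 1 ∨ A i = -1 <;> by_cases tB : ∃ i, B i = 1 ∨ B i = -1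
  · obtain ⟨i, hi⟩ := tA
    obtain ⟨j, hj⟩ := tB
    rw [← bell_swapR, ← bell_flip]
    exact bell_le_of_det hF.swapR.flip hC hA hB (Det₂.of_trivial _ hi) (Det₃.of_trivial _ hj)
  · by_cases tC : ∃ i, C i = 1 ∨ C i = -1
    · obtain ⟨i, hi⟩ := tA
      obtain ⟨j, hj⟩ := tC
      rw [← bell_flip]
      exact bell_le_of_det hF.flip hB hA hC (Det₂.of_trivial _ hi) (Det₃.of_trivial _ hj)
    · rw [← bell_flip, ← bell_swapR]
      exact h.flip.swapR.bell_le_of_nontrivial hF.flip.swapR hB hC hA (not_exists.1 tB)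
        (not_exists.1 tC)
  · by_cases tC : ∃ i, C i = 1 ∨ C i = -1
    · obtain ⟨i, hi⟩ := tB
      obtain ⟨j, hj⟩ := tC
      exact bell_le_of_det hF hA hB hC (Det₂.of_trivial _ hi) (Det₃.of_trivial _ hj)
    · rw [← bell_swapR]
      exact h.swapR.bell_le_of_nontrivial hF.swapR hA hC hB (not_exists.1 tA) (not_exists.1 tC)
  · exact h.bell_le_of_nontrivial hF hA hB hC (not_exists.1 tA) (not_exists.1 tB)

/-! ### Pauli matrices as frames -/

lemma pauli_zero : pauli 0 = 1 := rfl

lemma pauli_isHermitian (a : Fin 4) : (pauli a).IsHermitian := by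
  fin_cases a <;> ext i j <;> fin_cases i <;> fin_cases j <;> simp [pauli]

lemma pauli_sq (a : Fin 4) : pauli a * pauli a = 1 := by
  fin_cases a <;> ext i j <;> fin_cases i <;> fin_cases j <;>
    simp [pauli, Matrix.mul_apply, Fin.sum_univ_two]

lemma pauli_mul (a b : Fin 4) : ∃ u : ℂ, u ≠ 0 ∧ pauli a * pauli b = u • pauli (a ^^^ b) := by
  have key : pauli a * pauli b = pauli (a ^^^ b) ∨ pauli a * pauli b = I • pauli (a ^^^ b) ∨
      pauli a * pauli b = (-I) • pauli (a ^^^ b) := by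
    fin_cases a <;> fin_cases b <;>
    first
    | (left; ext i j; fin_cases i <;> fin_cases j <;>
        simp [pauli, Matrix.mul_apply, Fin.sum_univ_two]; done)
    | (right; left; ext i j; fin_cases i <;> fin_cases j <;>
        simp [pauli, Matrix.mul_apply, Fin.sum_univ_two]; done)
    | (right; right; ext i j; fin_cases i <;> fin_cases j <;>
        simp [pauli, Matrix.mul_apply, Fin.sum_univ_two])
  rcases key with h | h | h
  · exact ⟨1, one_ne_zero, by rw [h, one_smul]⟩
  · exact ⟨I, I_ne_zero, h⟩
  · exact ⟨-I, neg_ne_zero.2 I_ne_zero, h⟩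

/-- The sign `±1` with which two Pauli matrices commute. -/
def sgn (a b : Fin 4) : ℤ := if a = 0 ∨ b = 0 ∨ a = b then 1 else -1

lemma pauli_comm (a b : Fin 4) : pauli a * pauli b = ((sgn a b : ℤ) : ℂ) • (pauli b * pauli a) := by
  unfold sgn
  split_ifs with h
  · rcases h with rfl | rfl | rfl <;> simp [pauli_zero]
  · revert h
    fin_cases a <;> fin_cases b <;> intro h <;> (try simp at h) <;>
    ext i j <;> fin_cases i <;> fin_cases j <;>
        simp [pauli, Matrix.mul_apply, Fin.sum_univ_two]

lemma sgn_eq_one_iff {a b : Fin 4} : sgn a b = 1 ↔ a = 0 ∨ b = 0 ∨ a = b := by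
  unfold sgn; split_ifs with h <;> simp [h]

lemma sgn_eq (a b : Fin 4) : sgn a b = 1 ∨ sgn a b = -1 := by
  unfold sgn; split_ifs <;> simp

/-- A dichotomic observable of one qubit is `±1`, if its trace does not vanish, or has a unit Bloch
vector. -/
lemma exists_coord {A : M2} (h : IsDichotomic A) : (A = 1 ∨ A = -1) ∨ ∃ n : Fin 4 → ℝ,
    n 1 ^ 2 + n 2 ^ 2 + n 3 ^ 2 = 1 ∧
    A = (n 1 : ℂ) • pauli 1 + (n 2 : ℂ) • pauli 2 + (n 3 : ℂ) • pauli 3 := by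
  obtain ⟨hH, hS⟩ := h
  have d0 : (A 0 0).im = 0 := by
    have := congrArg Complex.im (hH.apply 0 0); simp at this; linarith
  have d1 : (A 1 1).im = 0 := by
    have := congrArg Complex.im (hH.apply 1 1); simp at this; linarith
  have re10 : (A 1 0).re = (A 0 1).re := by
    have := congrArg Complex.re (hH.apply 0 1); simpa using this
  have im10 : (A 1 0).im = -(A 0 1).im := by
    have := congrArg Complex.im (hH.apply 0 1); simp at this; linarith
  have s00 := congrFun (congrFun hS 0) 0
  have s01 := congrFun (congrFun hS 0) 1
  have s11 := congrFun (congrFun hS 1) 1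
  simp only [Matrix.mul_apply, Fin.sum_univ_two, Matrix.one_apply_eq] at s00 s01 s11
  have r00 := congrArg Complex.re s00
  have r01 := congrArg Complex.re s01
  have i01 := congrArg Complex.im s01
  have r11 := congrArg Complex.re s11
  simp only [Complex.add_re, Complex.mul_re, Complex.add_im, Complex.mul_im, d0, d1, re10, im10,
    Complex.one_re] at r00 r01 i01 r11
  rw [Matrix.one_apply_ne (by decide)] at r01 i01
  simp only [Complex.zero_re, Complex.zero_im] at r01 i01
  -- the off-diagonal entry of `A * A = 1` says `A 0 1 * A.trace = 0`
  have e1 : (A 0 1).re * ((A 0 0).re + (A 1 1).re) = 0 := by linarith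
  have e2 : (A 0 1).im * ((A 0 0).re + (A 1 1).re) = 0 := by linarith
  by_cases ht : (A 0 0).re + (A 1 1).re = 0
  · refine Or.inr ⟨![0, (A 0 1).re, -(A 0 1).im, (A 0 0).re], ?_, ?_⟩
    · simp; linarith
    · ext i j
      fin_cases i <;> fin_cases j <;> apply Complex.ext <;>
        simp [pauli, d0, d1, re10, im10]
      linarith
  · have f1 := (mul_eq_zero.1 e1).resolve_right ht
    have f2 := (mul_eq_zero.1 e2).resolve_right ht
    rw [f1, f2] at r00 r11
    have g0 : ((A 0 0).re - (A 1 1).re) * ((A 0 0).re + (A 1 1).re) = 0 := by linarith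
    have g1 := (mul_eq_zero.1 g0).resolve_right ht
    have g2 : ((A 0 0).re - 1) * ((A 0 0).re + 1) = 0 := by linarith
    left
    rcases mul_eq_zero.1 g2 with g | g
    · left
      ext i j
      fin_cases i <;> fin_cases j <;> apply Complex.ext <;> simp [d0, d1, re10, im10, f1, f2] <;>
        linarith
    · right
      ext i j
      fin_cases i <;> fin_cases j <;> apply Complex.ext <;> simp [d0, d1, re10, im10, f1, f2] <;>
        linarith

lemma pauli_mul_cyclic :
    I • (pauli 1 * pauli 2) = -pauli 3 ∧ I • (pauli 2 * pauli 3) = -pauli 1 ∧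
    I • (pauli 3 * pauli 1) = -pauli 2 ∧ I • (pauli 2 * pauli 1) = pauli 3 ∧
    I • (pauli 3 * pauli 2) = pauli 1 ∧ I • (pauli 1 * pauli 3) = pauli 2 := by
  refine ⟨?_, ?_, ?_, ?_, ?_, ?_⟩ <;> ext i j <;> fin_cases i <;> fin_cases j <;> simp [pauli]

lemma isFrame_pauli {h a : Fin 4} (h0 : h ≠ 0) (a0 : a ≠ 0) (ha : h ≠ a) :
    IsFrame (pauli h) (pauli a) := by
  refine ⟨pauli_sq h, pauli_sq a, ?_, ?_⟩
  · rw [pauli_comm a h, sgn, if_neg (by tauto)]; simp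
  · intro A hA
    refine (exists_coord hA).imp_right ?_
    rintro ⟨n, hn, rfl⟩
    have key : ∃ y : ℝ, y ^ 2 = 1 - n h ^ 2 - n a ^ 2 ∧
        (n 1 : ℂ) • pauli 1 + (n 2 : ℂ) • pauli 2 + (n 3 : ℂ) • pauli 3 =
          frameVec (pauli h) (pauli a) (n h) y (n a) := by
      fin_cases h <;> fin_cases a <;> (try simp at h0 a0 ha)
      · exact ⟨-n 3, by simp; linarith, by
          simp [frameVec, pauli_mul_cyclic]; try abel⟩
      · exact ⟨n 2, by simp; linarith, by
          simp [frameVec, pauli_mul_cyclic]; try abel⟩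
      · exact ⟨n 3, by simp; linarith, by
          simp [frameVec, pauli_mul_cyclic]; try abel⟩
      · exact ⟨-n 1, by simp; linarith, by
          simp [frameVec, pauli_mul_cyclic]; try abel⟩
      · exact ⟨-n 2, by simp; linarith, by
          simp [frameVec, pauli_mul_cyclic]; try abel⟩
      · exact ⟨n 1, by simp; linarith, by
          simp [frameVec, pauli_mul_cyclic]; try abel⟩
    obtain ⟨y, hy, e⟩ := key
    exact ⟨n h, y, n a, by linarith, e⟩

lemma IsFrame.smul {X Z : M2} (h : IsFrame X Z) {ε δ : ℝ} (hε : ε ^ 2 = 1) (hδ : δ ^ 2 = 1) :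
    IsFrame ((ε : ℂ) • X) ((δ : ℂ) • Z) := by
  have hε' : (ε : ℂ) * ε = 1 := by rw [← sq]; exact_mod_cast hε
  have hδ' : (δ : ℂ) * δ = 1 := by rw [← sq]; exact_mod_cast hδ
  refine ⟨?_, ?_, ?_, ?_⟩
  · rw [smul_mul_smul_comm, hε', h.X_sq, one_smul]
  · rw [smul_mul_smul_comm, hδ', h.Z_sq, one_smul]
  · rw [smul_mul_smul_comm, smul_mul_smul_comm, h.anti, smul_neg, mul_comm]
  · intro A hA
    refine (h.coord A hA).imp_right ?_
    rintro ⟨x, y, z, hn, rfl⟩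
    refine ⟨x * ε, y * (ε * δ), z * δ, by
      rw [mul_pow, mul_pow, mul_pow, mul_pow, hε, hδ]; linarith, ?_⟩
    simp only [frameVec, smul_mul_smul_comm, smul_smul]
    push_cast
    congr 1
    · congr 1
      · rw [mul_assoc, hε', mul_one]
      · congr 1
        linear_combination (-(y : ℂ) * I * δ * δ) * hε' - y * I * hδ'
    · rw [mul_assoc, hδ', mul_one]

/-! ### Classification by Pauli labels -/

/-- The Pauli operator labelled by `(a, b, c)` stabilizes `F` up to a phase. The bitwise `xor` of
labels describes the product of Pauli matrices up to a phase. -/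
def Fixes (F : Tri) (a b c : Fin 4) : Prop := ∃ ε, Stab F (pauli a) (pauli b) (pauli c) ε

lemma xor_self (a : Fin 4) : a ^^^ a = 0 := by revert a; decide
lemma xor_ne_zero {a b : Fin 4} (h : a ≠ b) : a ^^^ b ≠ 0 := by revert a b; decide

namespace Fixes
variable {F : Tri} {a b c a' b' c' : Fin 4}

/-- The fixing labels form a group under `xor`. -/
lemma mul (h : Fixes F a b c) (h' : Fixes F a' b' c') :
    Fixes F (a ^^^ a') (b ^^^ b') (c ^^^ c') := by
  obtain ⟨ε, h⟩ := h
  obtain ⟨ε', h'⟩ := h'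
  obtain ⟨u, hu, eu⟩ := pauli_mul a a'
  obtain ⟨v, hv, ev⟩ := pauli_mul b b'
  obtain ⟨w, hw, ew⟩ := pauli_mul c c'
  have := h.mul h'
  rw [eu, ev, ew] at this
  have := this.smul u⁻¹ v⁻¹ w⁻¹
  rw [inv_smul_smul₀ hu, inv_smul_smul₀ hv, inv_smul_smul₀ hw] at this
  exact ⟨_, this⟩

/-- The phase is a sign because Pauli operators square to `1`. -/
lemma sign (hF : IsState F) (h : Fixes F a b c) : ∃ ε : ℝ, ε ^ 2 = 1 ∧
    Stab F (pauli a) (pauli b) (pauli c) ε := by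
  obtain ⟨ε, h⟩ := h
  have h2 := ((h.mul h) 1 1 1).1
  simp only [pauli_sq, mul_one, hF.norm] at h2
  rcases mul_self_eq_one_iff.1 h2.symm with rfl | rfl
  · exact ⟨1, by norm_num, by simpa using h⟩
  · exact ⟨-1, by norm_num, by simpa using h⟩

lemma eq_zero (hF : IsState F) (h : Fixes F a b c)
    (hs : sgn a a' * sgn b b' * sgn c c' = -1) : F (pauli a') (pauli b') (pauli c') = 0 := by
  obtain ⟨ε, hε, h⟩ := h.sign hF
  refine h.eq_zero ?_ _ _ _ (pauli_comm a a') (pauli_comm b b') (pauli_comm c c')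
    (by exact_mod_cast hs)
  rintro h0
  rw [Complex.ofReal_eq_zero] at h0
  rw [h0] at hε; norm_num at hε

/-- Two Pauli operators with a common eigenvector commute, since otherwise they anticommute. -/
lemma comm (hF : IsState F) (h : Fixes F a b c) (h' : Fixes F a' b' c') :
    sgn a a' * sgn b b' * sgn c c' = 1 := by
  by_contra hne
  have hs : sgn a a' * sgn b b' * sgn c c' = -1 := by
    rcases sgn_eq a a' with e | e <;> rcases sgn_eq b b' with e' | e' <;>
      rcases sgn_eq c c' with e'' | e'' <;> simp [e, e', e''] at hne ⊢
  have h0 := h.eq_zero hF hs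
  obtain ⟨ε, hε, h'⟩ := h'.sign hF
  have := (h' 1 1 1).1
  simp only [mul_one, hF.norm, h0] at this
  have : ε = 0 := by exact_mod_cast this.symm
  rw [this] at hε; norm_num at hε

lemma flip (h : Fixes F a b c) : Fixes F.flip b a c := h.imp fun _ h => h.flip
lemma swapR (h : Fixes F a b c) : Fixes (swapR F) a c b := h.imp fun _ h => h.swapR

end Fixes

/-- At least eight Pauli labels fix the form `F`. -/
def HasEightStabilizers (F : Tri) : Prop :=
  ∃ g : Fin 8 → Fin 4 × Fin 4 × Fin 4, Function.Injective g ∧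
    ∀ i, Fixes F (g i).1 (g i).2.1 (g i).2.2

lemma HasEightStabilizers.flip {F : Tri} (h : HasEightStabilizers F) :
    HasEightStabilizers F.flip := by
  obtain ⟨g, hg, h⟩ := h
  refine ⟨fun i => ((g i).2.1, (g i).1, (g i).2.2), fun i j hij => hg ?_, fun i => (h i).flip⟩
  simp only [Prod.mk.injEq] at hij
  exact Prod.ext hij.2.1 (Prod.ext hij.1 hij.2.2)

lemma HasEightStabilizers.swapR {F : Tri} (h : HasEightStabilizers F) :
    HasEightStabilizers (swapR F) := by
  obtain ⟨g, hg, h⟩ := h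
  refine ⟨fun i => ((g i).1, (g i).2.2, (g i).2.1), fun i j hij => hg ?_, fun i => (h i).swapR⟩
  simp only [Prod.mk.injEq] at hij
  exact Prod.ext hij.1 (Prod.ext hij.2.2 hij.2.1)

/-- A Pauli matrix of the first qubit alone is a stabilizer: this qubit is in a pure state. -/
def Sep₁ (F : Tri) : Prop := ∃ a, a ≠ 0 ∧ Fixes F a 0 0
/-- The second qubit is in a pure state. -/
def Sep₂ (F : Tri) : Prop := ∃ a, a ≠ 0 ∧ Fixes F 0 a 0
/-- The third qubit is in a pure state. -/
def Sep₃ (F : Tri) : Prop := ∃ a, a ≠ 0 ∧ Fixes F 0 0 a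

/-- The scalar is the expectation value of the observable in the pure state of the qubit. -/
lemma Sep₃.det {F : Tri} (hF : IsState F) (h : Sep₃ F) {A : M2} (hA : IsDichotomic A) :
    Det₃ F A := by
  obtain ⟨c, hc, h⟩ := h
  obtain ⟨d, hd, hdc⟩ : ∃ d : Fin 4, d ≠ 0 ∧ d ≠ c := by clear hc h; revert c; decide
  obtain ⟨ε, hε, h⟩ := h.sign hF
  rw [pauli_zero] at h
  have f := isFrame_pauli hd hc hdc
  have hε0 : (ε : ℂ) ≠ 0 := by
    rintro h0
    rw [Complex.ofReal_eq_zero] at h0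
    rw [h0] at hε; norm_num at hε
  rcases f.coord A hA with h1 | ⟨x, y, z, hn, rfl⟩
  · exact Det₃.of_trivial F h1
  · have hz : z ^ 2 ≤ 1 := by nlinarith
    refine ⟨z * ε, ?_, ?_, fun u v => ?_⟩
    · nlinarith [sq_nonneg (z + ε)]
    · nlinarith [sq_nonneg (z - ε)]
    · have e1 : F u v (pauli d) = 0 := h.eq_zero hε0 1 1 (-1) (by simp) (by simp)
        f.Z_mul_X (by norm_num)
      have e2 : F u v (pauli d * pauli c) = 0 := h.eq_zero hε0 1 1 (-1) (by simp) (by simp)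
        f.Z_mul_Y (by norm_num)
      have e3 : F u v (pauli c) = ε * F u v 1 := by simpa using (h u v 1).1
      simp only [frameVec, map_add, map_smul, smul_eq_mul, e1, e2, e3]
      push_cast; ring

lemma Sep₂.det {F : Tri} (hF : IsState F) (h : Sep₂ F) {A : M2} (hA : IsDichotomic A) :
    Det₂ F A := by
  have h' : Sep₃ (swapR F) := by obtain ⟨a, ha, h⟩ := h; exact ⟨a, ha, h.swapR⟩
  obtain ⟨t, h1, h2, h3⟩ := h'.det hF.swapR hA
  exact ⟨t, h1, h2, fun x y => h3 x y⟩

/-- If the third qubit is in a pure state and the first is not, then the first is maximally mixed.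
Were `F (pauli b) 1 1 ≠ 0`, no stabilizer would anticommute with `pauli b` on the first qubit. So
the first and the third letters of the stabilizers would each commute among themselves, hence so
would the second letters, and this leaves only two letters at each place. Two of the eight labels
would then agree outside the first qubit, and their product would act on the first qubit alone. -/
lemma marginal_eq_zero {F : Tri} (hF : IsState F) (hR : HasEightStabilizers F) (h3 : Sep₃ F)
    (h1 : ¬ Sep₁ F) (b : Fin 4) (hb : b ≠ 0) : F (pauli b) 1 1 = 0 := by
  obtain ⟨g, hg, hfix⟩ := hR
  obtain ⟨c, hc, hc'⟩ := h3
  by_contra hne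
  have e1 : ∀ i, sgn (g i).1 b = 1 := by
    intro i
    refine (sgn_eq _ _).resolve_right fun h => hne ?_
    exact (hfix i).eq_zero hF (a' := b) (b' := 0) (c' := 0) (by
      rw [h]; simp [sgn])
  have e1' : ∀ i, (g i).1 = 0 ∨ (g i).1 = b := fun i => by
    have := sgn_eq_one_iff.1 (e1 i); tauto
  have e3' : ∀ i, (g i).2.2 = 0 ∨ (g i).2.2 = c := fun i => by
    have := (hfix i).comm hF hc'
    simp only [sgn, or_true, true_or, if_true, one_mul] at this
    have := sgn_eq_one_iff.1 this; tauto
  have com : ∀ {x y z : Fin 4}, (x = 0 ∨ x = z) → (y = 0 ∨ y = z) → sgn x y = 1 := by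
    intro x y z hx hy
    rw [sgn_eq_one_iff]
    rcases hx with rfl | rfl <;> rcases hy with rfl | rfl <;> simp
  have e2 : ∀ i j, (g i).2.1 = 0 ∨ (g j).2.1 = 0 ∨ (g i).2.1 = (g j).2.1 := fun i j => by
    have := (hfix i).comm hF (hfix j)
    rw [com (e1' i) (e1' j), com (e3' i) (e3' j), one_mul, mul_one] at this
    exact sgn_eq_one_iff.1 this
  obtain ⟨d, hd⟩ : ∃ d, ∀ i, (g i).2.1 = 0 ∨ (g i).2.1 = d := by
    by_cases h : ∃ i, (g i).2.1 ≠ 0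
    · obtain ⟨i, hi⟩ := h
      exact ⟨(g i).2.1, fun j => by have := e2 j i; tauto⟩
    · push Not at h
      exact ⟨0, fun i => Or.inl (h i)⟩
  obtain ⟨i, -, j, -, hij, heq⟩ := Finset.exists_ne_map_eq_of_card_lt_of_maps_to
    (s := (Finset.univ : Finset (Fin 8)))
    (t := ({0, d} : Finset (Fin 4)) ×ˢ ({0, c} : Finset (Fin 4))) (f := fun i => (g i).2) (by
      rw [Finset.card_product]
      have := Finset.card_le_two (a := (0 : Fin 4)) (b := d)
      have := Finset.card_le_two (a := (0 : Fin 4)) (b := c)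
      simp only [Finset.card_univ, Fintype.card_fin]
      nlinarith) (fun i _ => by simpa using ⟨hd i, e3' i⟩)
  have hne1 : (g i).1 ≠ (g j).1 := fun h => hij (hg (Prod.ext h heq))
  have hm := (hfix i).mul (hfix j)
  have heq' : (g i).2 = (g j).2 := heq
  rw [heq', xor_self, xor_self] at hm
  exact h1 ⟨_, xor_ne_zero hne1, hm⟩

lemma marginal_nontrivial {F : Tri} (hF : IsState F) (hR : HasEightStabilizers F) (h3 : Sep₃ F)
    (h1 : ¬ Sep₁ F) {A : M2} (hA : IsDichotomic A) (hA' : ¬ (A = 1 ∨ A = -1)) : F A 1 1 = 0 := by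
  obtain ⟨n, -, rfl⟩ := (exists_coord hA).resolve_left hA'
  simp only [map_add, map_smul, LinearMap.add_apply, LinearMap.smul_apply,
    marginal_eq_zero hF hR h3 h1 _ (by decide : (1 : Fin 4) ≠ 0),
    marginal_eq_zero hF hR h3 h1 _ (by decide : (2 : Fin 4) ≠ 0),
    marginal_eq_zero hF hR h3 h1 _ (by decide : (3 : Fin 4) ≠ 0), smul_zero, add_zero]

lemma sep₁_flip {F : Tri} : Sep₁ F.flip ↔ Sep₂ F :=
  ⟨fun ⟨a, h, h'⟩ => ⟨a, h, h'.flip⟩, fun ⟨a, h, h'⟩ => ⟨a, h, h'.flip⟩⟩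
lemma sep₂_flip {F : Tri} : Sep₂ F.flip ↔ Sep₁ F :=
  ⟨fun ⟨a, h, h'⟩ => ⟨a, h, h'.flip⟩, fun ⟨a, h, h'⟩ => ⟨a, h, h'.flip⟩⟩
lemma sep₃_flip {F : Tri} : Sep₃ F.flip ↔ Sep₃ F :=
  ⟨fun ⟨a, h, h'⟩ => ⟨a, h, h'.flip⟩, fun ⟨a, h, h'⟩ => ⟨a, h, h'.flip⟩⟩
lemma sep₃_swapR {F : Tri} : Sep₃ (swapR F) ↔ Sep₂ F :=
  ⟨fun ⟨a, h, h'⟩ => ⟨a, h, h'.swapR⟩, fun ⟨a, h, h'⟩ => ⟨a, h, h'.swapR⟩⟩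

/-- The bound when the third qubit is in a pure state. -/
lemma bell_le_of_sep₃ {F : Tri} (hF : IsState F) (hR : HasEightStabilizers F) (h3 : Sep₃ F)
    {A B C : Fin 2 → M2} (hA : ∀ i, IsDichotomic (A i)) (hB : ∀ i, IsDichotomic (B i))
    (hC : ∀ i, IsDichotomic (C i)) : bell F A B C ≤ 6 := by
  have hC' := fun k => h3.det hF (hC k)
  have h3' := sep₃_flip.2 h3
  have hC'' := fun k => h3'.det hF.flip (hC k)
  by_cases h2 : Sep₂ F
  · exact bell_le_of_det hF hA hB hC (h2.det hF (hB 0)) (hC' 0)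
  by_cases h1 : Sep₁ F
  · rw [← bell_flip]
    exact bell_le_of_det hF.flip hB hA hC ((sep₂_flip.2 h1).det hF.flip (hA 0)) (hC'' 0)
  by_cases tB : ∃ j, B j = 1 ∨ B j = -1
  · obtain ⟨j, hj⟩ := tB
    exact bell_le_of_det hF hA hB hC (Det₂.of_trivial F hj) (hC' 0)
  by_cases tA : ∃ j, A j = 1 ∨ A j = -1
  · obtain ⟨j, hj⟩ := tA
    rw [← bell_flip]
    exact bell_le_of_det hF.flip hB hA hC (Det₂.of_trivial _ hj) (hC'' 0)
  push Not at tA tB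
  refine bell_le_of_marginals hF hA hB (fun i => ?_) (fun j => ?_) hC'
  · exact marginal_nontrivial hF hR h3 h1 (hA i) (by have := tA i; tauto)
  · exact marginal_nontrivial hF.flip hR.flip h3' (by rwa [sep₁_flip]) (hB j)
      (by have := tB j; tauto)

/-- Two of eight labels agree on the third qubit; their product acts on the first two qubits. -/
lemma exists_weight_two {F : Tri} (hR : HasEightStabilizers F) (h1 : ¬ Sep₁ F) (h2 : ¬ Sep₂ F) :
    ∃ a b, a ≠ 0 ∧ b ≠ 0 ∧ Fixes F a b 0 := by
  obtain ⟨g, hg, hfix⟩ := hR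
  obtain ⟨i, j, hij, heq⟩ := Fintype.exists_ne_map_eq_of_card_lt (fun i => (g i).2.2) (by simp)
  have hm := (hfix i).mul (hfix j)
  have heq' : (g i).2.2 = (g j).2.2 := heq
  rw [heq', xor_self] at hm
  refine ⟨_, _, fun ha => ?_, fun hb => ?_, hm⟩
  · rw [ha] at hm
    refine h2 ⟨_, fun hb => hij (hg ?_), hm⟩
    refine Prod.ext ?_ (Prod.ext ?_ heq)
    · exact not_not.1 fun h => xor_ne_zero h ha
    · exact not_not.1 fun h => xor_ne_zero h hb
  · rw [hb] at hm
    refine h1 ⟨_, fun ha => hij (hg ?_), hm⟩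
    refine Prod.ext ?_ (Prod.ext ?_ heq)
    · exact not_not.1 fun h => xor_ne_zero h ha
    · exact not_not.1 fun h => xor_ne_zero h hb

/-- If no qubit is in a pure state, the state is of GHZ type. There are stabilizers `(a, b, 0)` and
`(a, 0, c)`, with the same `a` because they commute, and a stabilizer outside the group that these
two generate. It commutes with both, so its letters commute with all of `a, b, c` or with none. In
the first case it would yield a stabilizer of weight one, so the second holds: it provides the
operators `X` of the frames, and `a, b, c` the operators `Z`; the signs are absorbed into these. -/
lemma exists_isGHZ {F : Tri} (hF : IsState F) (hR : HasEightStabilizers F) (h1 : ¬ Sep₁ F)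
    (h2 : ¬ Sep₂ F) (h3 : ¬ Sep₃ F) : ∃ X₁ Z₁ X₂ Z₂ X₃ Z₃, IsGHZ F X₁ Z₁ X₂ Z₂ X₃ Z₃ := by
  obtain ⟨a, b, a0, b0, hab⟩ := exists_weight_two hR h1 h2
  obtain ⟨a', c, a0', c0, hac⟩ := exists_weight_two (F := swapR F) hR.swapR
    (fun ⟨a, h, h'⟩ => h1 ⟨a, h, h'.swapR⟩) (fun ⟨a, h, h'⟩ => h3 ⟨a, h, h'.swapR⟩)
  replace hac : Fixes F a' 0 c := hac.swapR
  obtain rfl : a = a' := by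
    have := hab.comm hF hac
    simp only [sgn, true_or, or_true, if_true, mul_one] at this
    have := sgn_eq_one_iff.1 this; tauto
  obtain ⟨g, hg, hfix⟩ := hR
  obtain ⟨i, hi⟩ : ∃ i, g i ∉ ({(0, 0, 0), (a, b, 0), (a, 0, c), (0, b, c)} :
      Finset (Fin 4 × Fin 4 × Fin 4)) := by
    by_contra! h
    have := Finset.card_le_card_of_injOn g (s := Finset.univ) (fun i _ => h i) hg.injOn
    have h4 := Finset.card_le_four (a := ((0, 0, 0) : Fin 4 × Fin 4 × Fin 4)) (b := (a, b, 0))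
      (c := (a, 0, c)) (d := (0, b, c))
    simp only [Finset.card_univ, Fintype.card_fin] at this
    omega
  obtain ⟨x, y, z, hx, hxyz⟩ : ∃ x y z, g i = (x, y, z) ∧ Fixes F x y z := ⟨_, _, _, rfl, hfix i⟩
  rw [hx] at hi
  have c1 := hxyz.comm hF hab
  have c2 := hxyz.comm hF hac
  simp only [sgn_eq_one_iff.2 (Or.inr (Or.inl rfl) : _ ∨ (0 : Fin 4) = 0 ∨ _), mul_one] at c1 c2
  have q1 : sgn x a = sgn y b := by
    rcases sgn_eq x a with e | e <;> rcases sgn_eq y b with e' | e' <;> simp [e, e'] at c1 ⊢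
  have q2 : sgn x a = sgn z c := by
    rcases sgn_eq x a with e | e <;> rcases sgn_eq z c with e' | e' <;> simp [e, e'] at c2 ⊢
  have hx1 : sgn x a ≠ 1 := by
    intro e
    have ex := sgn_eq_one_iff.1 e
    have ey := sgn_eq_one_iff.1 (q1 ▸ e)
    have ez := sgn_eq_one_iff.1 (q2 ▸ e)
    replace ex : x = 0 ∨ x = a := by tauto
    replace ey : y = 0 ∨ y = b := by tauto
    replace ez : z = 0 ∨ z = c := by tauto
    rcases ex with rfl | rfl <;> rcases ey with rfl | rfl <;> rcases ez with rfl | rfl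
    · simp at hi
    · exact h3 ⟨_, c0, hxyz⟩
    · exact h2 ⟨_, b0, hxyz⟩
    · simp at hi
    · exact h1 ⟨_, a0, hxyz⟩
    · simp at hi
    · simp at hi
    · have := hxyz.mul hab
      rw [xor_self, xor_self] at this
      exact h3 ⟨_, xor_ne_zero c0, this⟩
  have nx : x ≠ 0 ∧ x ≠ a := by rw [Ne, sgn_eq_one_iff] at hx1; tauto
  have ny : y ≠ 0 ∧ y ≠ b := by rw [q1, Ne, sgn_eq_one_iff] at hx1; tauto
  have nz : z ≠ 0 ∧ z ≠ c := by rw [q2, Ne, sgn_eq_one_iff] at hx1; tauto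
  obtain ⟨ε, hε, sX⟩ := hxyz.sign hF
  obtain ⟨δ, hδ, s12⟩ := hab.sign hF
  obtain ⟨η, hη, s13⟩ := hac.sign hF
  have sq' : ∀ {ε : ℝ}, ε ^ 2 = 1 → (ε : ℂ) * ε = 1 := by
    intro ε h; rw [← sq]; exact_mod_cast h
  have t12 : Stab F (pauli a) ((δ : ℂ) • pauli b) 1 1 := by
    simpa [sq' hδ, pauli_zero] using s12.smul 1 δ 1
  have t13 : Stab F (pauli a) 1 ((η : ℂ) • pauli c) 1 := by
    simpa [sq' hη, pauli_zero] using s13.smul 1 1 η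
  have one : (1 : ℝ) ^ 2 = 1 := one_pow 2
  refine ⟨(ε : ℂ) • pauli x, pauli a, pauli y, (δ : ℂ) • pauli b, pauli z, (η : ℂ) • pauli c,
    ?_, ?_, ?_, hF.norm, ?_, t12, t13, ?_⟩
  · simpa using (isFrame_pauli nx.1 a0 nx.2).smul hε one
  · simpa using (isFrame_pauli ny.1 b0 ny.2).smul one hδ
  · simpa using (isFrame_pauli nz.1 c0 nz.2).smul one hη
  · simpa [sq' hε] using sX.smul ε 1 1
  · simpa [pauli_sq] using t12.mul t13

/-- The bound for every form with the stabilizers of a pure three-qubit stabilizer state. -/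
lemma bell_le {F : Tri} (hF : IsState F) (hR : HasEightStabilizers F) {A B C : Fin 2 → M2}
    (hA : ∀ i, IsDichotomic (A i)) (hB : ∀ i, IsDichotomic (B i)) (hC : ∀ i, IsDichotomic (C i)) :
    bell F A B C ≤ 6 := by
  by_cases h3 : Sep₃ F
  · exact bell_le_of_sep₃ hF hR h3 hA hB hC
  by_cases h2 : Sep₂ F
  · rw [← bell_swapR]
    exact bell_le_of_sep₃ hF.swapR hR.swapR (sep₃_swapR.2 h2) hA hC hB
  by_cases h1 : Sep₁ F
  · rw [← bell_flip, ← bell_swapR]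
    exact bell_le_of_sep₃ hF.flip.swapR hR.flip.swapR (sep₃_swapR.2 (sep₂_flip.2 h1)) hB hC hA
  obtain ⟨_, _, _, _, _, _, h⟩ := exists_isGHZ hF hR h1 h2 h3
  exact h.bell_le hF hA hB hC

/-! ### Stabilizer states and their mixtures -/

lemma tensorOp_mul {n : ℕ} (A B : Fin n → M2) :
    tensorOp A * tensorOp B = tensorOp (fun j => A j * B j) := by
  ext x y
  simp only [tensorOp, Matrix.mul_apply, Matrix.of_apply, ← Finset.prod_mul_distrib]
  rw [Finset.prod_univ_sum, Fintype.piFinset_univ]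

lemma tensorOp_conjTranspose {n : ℕ} (A : Fin n → M2) :
    (tensorOp A)ᴴ = tensorOp (fun j => (A j)ᴴ) := by
  ext x y
  simp [tensorOp, Matrix.conjTranspose_apply]

lemma tensorOp_one {n : ℕ} : tensorOp (fun _ : Fin n => (1 : M2)) = 1 := by
  ext x y
  simp only [tensorOp, Matrix.of_apply, Matrix.one_apply, Finset.prod_ite_zero]
  simp [funext_iff]

lemma tensorOp_three_mul (a b c a' b' c' : M2) :
    tensorOp ![a, b, c] * tensorOp ![a', b', c'] = tensorOp ![a * a', b * b', c * c'] := by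
  rw [tensorOp_mul]; congr 1; funext j; fin_cases j <;> rfl

lemma tensorOp_three_one : tensorOp ![(1 : M2), 1, 1] = 1 := by
  rw [← tensorOp_one]; congr 1; funext j; fin_cases j <;> rfl

lemma tensorOp_three_apply (a b c : M2) (x y : Basis 3) :
    tensorOp ![a, b, c] x y = a (x 0) (y 0) * b (x 1) (y 1) * c (x 2) (y 2) := by
  rw [tensorOp, Matrix.of_apply, Fin.prod_univ_three]; rfl

/-- `c ↦ tr(ρ (a ⊗ b ⊗ c))` as a linear map. -/
def expectSlot (ρ : Op 3) (a b : M2) : M2 →ₗ[ℂ] ℂ where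
  toFun c := (ρ * tensorOp ![a, b, c]).trace
  map_add' c c' := by
    rw [← Matrix.trace_add, ← mul_add]
    congr 2; ext x y; simp only [tensorOp_three_apply, Matrix.add_apply]; ring
  map_smul' r c := by
    rw [RingHom.id_apply, ← Matrix.trace_smul, ← mul_smul_comm]
    congr 2; ext x y; simp only [tensorOp_three_apply, Matrix.smul_apply, smul_eq_mul]; ring

lemma expectSlot_apply (ρ : Op 3) (a b c : M2) :
    expectSlot ρ a b c = (ρ * tensorOp ![a, b, c]).trace := rfl

/-- The trilinear form `(a, b, c) ↦ tr(ρ (a ⊗ b ⊗ c))`. -/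
def expectTri (ρ : Op 3) : Tri :=
  LinearMap.mk₂ ℂ (expectSlot ρ)
    (fun a a' b => LinearMap.ext fun c => by
      simp only [LinearMap.add_apply, expectSlot_apply]
      rw [← Matrix.trace_add, ← mul_add]
      congr 2; ext x y; simp only [tensorOp_three_apply, Matrix.add_apply]; ring)
    (fun r a b => LinearMap.ext fun c => by
      simp only [LinearMap.smul_apply, expectSlot_apply]
      rw [← Matrix.trace_smul, ← mul_smul_comm]
      congr 2; ext x y; simp only [tensorOp_three_apply, Matrix.smul_apply, smul_eq_mul]; ring)
    (fun a b b' => LinearMap.ext fun c => by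
      simp only [LinearMap.add_apply, expectSlot_apply]
      rw [← Matrix.trace_add, ← mul_add]
      congr 2; ext x y; simp only [tensorOp_three_apply, Matrix.add_apply]; ring)
    (fun r a b => LinearMap.ext fun c => by
      simp only [LinearMap.smul_apply, expectSlot_apply]
      rw [← Matrix.trace_smul, ← mul_smul_comm]
      congr 2; ext x y; simp only [tensorOp_three_apply, Matrix.smul_apply, smul_eq_mul]; ring)

lemma expectTri_apply (ρ : Op 3) (a b c : M2) :
    expectTri ρ a b c = (ρ * tensorOp ![a, b, c]).trace := rfl

lemma S3_add_R2_eq_bell (ρ : Op 3) (A : Fin 3 → Fin 2 → M2) :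
    S3 ρ A + R2 ρ A = bell (expectTri ρ) (A 0) (A 1) (A 2) := by
  simp only [S3, R2, corr3, expect, bell, expectTri_apply, Fin.sum_univ_two]
  simp only [Fin.val_zero, Fin.val_one, pow_zero, pow_one, zero_add,
    show (1 : Fin 2) + 1 = 0 from rfl]
  ring

lemma ketbra_eq_vecMulVec {n : ℕ} (ψ : EuclideanSpace ℂ (Basis n)) :
    ketbra ψ = Matrix.vecMulVec (fun x => ψ x) (star fun x => ψ x) := rfl

lemma trace_ketbra {n : ℕ} {ψ : EuclideanSpace ℂ (Basis n)} (h : ‖ψ‖ = 1) :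
    (ketbra ψ).trace = 1 := by
  have h2 : ∑ i, ‖ψ i‖ ^ 2 = 1 := by rw [← EuclideanSpace.norm_sq_eq, h, one_pow]
  simp only [Matrix.trace, Matrix.diag, ketbra, Matrix.of_apply, Complex.star_def,
    Complex.mul_conj, Complex.normSq_eq_norm_sq]
  exact_mod_cast h2

open scoped ComplexOrder in
lemma isState_ketbra {ψ : EuclideanSpace ℂ (Basis 3)} (h : ‖ψ‖ = 1) :
    IsState (expectTri (ketbra ψ)) := by
  refine ⟨by rw [expectTri_apply, tensorOp_three_one, mul_one, trace_ketbra h], ?_⟩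
  intro a b c ha hb hc
  -- `1 + a` is twice a projection, hence of the form `Nᴴ * N`
  have key : ∀ {a : M2}, IsDichotomic a → 1 + a = (1 / 2 : ℂ) • ((1 + a)ᴴ * (1 + a)) := by
    intro a ha
    rw [Matrix.conjTranspose_add, Matrix.conjTranspose_one, ha.1.eq]
    have : (1 + a) * (1 + a) = (2 : ℂ) • (1 + a) := by
      rw [add_mul, mul_add, mul_add, ha.2, two_smul]; simp; abel
    rw [this, smul_smul]; norm_num
  rw [key ha, key hb, key hc]
  simp only [map_smul, LinearMap.smul_apply, smul_eq_mul]
  have hM : tensorOp ![(1 + a)ᴴ * (1 + a), (1 + b)ᴴ * (1 + b), (1 + c)ᴴ * (1 + c)] =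
      (tensorOp ![1 + a, 1 + b, 1 + c])ᴴ * tensorOp ![1 + a, 1 + b, 1 + c] := by
    rw [tensorOp_conjTranspose, tensorOp_mul]
    congr 1; funext j; fin_cases j <;> rfl
  have hpos := (Matrix.posSemidef_conjTranspose_mul_self
    (tensorOp ![1 + a, 1 + b, 1 + c])).dotProduct_mulVec_nonneg (fun x => ψ x)
  rw [← hM] at hpos
  rw [expectTri_apply, ketbra_eq_vecMulVec, Matrix.trace_mul_comm, Matrix.mul_vecMulVec,
    Matrix.trace_vecMulVec, dotProduct_comm]
  generalize (star fun x => ψ x) ⬝ᵥ _ = w at hpos ⊢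
  have hw := (Complex.le_def.1 hpos).1
  have : (1 / 2 * (1 / 2 * (1 / 2 * w)) : ℂ) = ((1 / 8 : ℝ) : ℂ) * w := by push_cast; ring
  rw [this, Complex.re_ofReal_mul]
  exact mul_nonneg (by norm_num) hw

/-- A Pauli operator with eigenvector `ψ` stabilizes the form of `|ψ⟩⟨ψ|`; the eigenvalue is real,
so the action from the right agrees with the one from the left. -/
lemma stab_of_eigen {ψ : EuclideanSpace ℂ (Basis 3)} (h : ‖ψ‖ = 1) {p : Fin 3 → Fin 4} {ε : ℂ}
    (he : tensorOp (fun j => pauli (p j)) *ᵥ (fun x => ψ x) = ε • fun x => ψ x) :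
    Stab (expectTri (ketbra ψ)) (pauli (p 0)) (pauli (p 1)) (pauli (p 2)) ε := by
  have hT : tensorOp (fun j => pauli (p j)) =
      tensorOp ![pauli (p 0), pauli (p 1), pauli (p 2)] := by
    congr 1; funext j; fin_cases j <;> rfl
  have hH : (tensorOp (fun j => pauli (p j)))ᴴ = tensorOp (fun j => pauli (p j)) := by
    rw [tensorOp_conjTranspose]; congr 1; funext j; exact (pauli_isHermitian _).eq
  have hsq : tensorOp (fun j => pauli (p j)) * tensorOp (fun j => pauli (p j)) = 1 := by
    rw [tensorOp_mul, ← tensorOp_one]; congr 1; funext j; exact pauli_sq _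
  have hl : tensorOp (fun j => pauli (p j)) * ketbra ψ = ε • ketbra ψ := by
    rw [ketbra_eq_vecMulVec, Matrix.mul_vecMulVec, he, Matrix.smul_vecMulVec]
  have hρ : (ketbra ψ)ᴴ = ketbra ψ := by
    ext x y; simp [ketbra, Matrix.conjTranspose_apply, mul_comm]
  have hr : ketbra ψ * tensorOp (fun j => pauli (p j)) = star ε • ketbra ψ := by
    have := congrArg Matrix.conjTranspose hl
    rwa [Matrix.conjTranspose_mul, hH, hρ, Matrix.conjTranspose_smul, hρ] at this
  have hε : ε * ε = 1 := by
    have h1 : tensorOp (fun j => pauli (p j)) * (tensorOp (fun j => pauli (p j)) * ketbra ψ)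
        = ketbra ψ := by rw [← mul_assoc, hsq, one_mul]
    rw [hl, mul_smul_comm, hl, smul_smul] at h1
    have := congrArg Matrix.trace h1
    rwa [Matrix.trace_smul, trace_ketbra h, smul_eq_mul, mul_one] at this
  have hstar : star ε = ε := by
    rcases mul_self_eq_one_iff.1 hε with rfl | rfl <;> simp
  rw [hstar] at hr
  rw [hT] at hl hr
  intro x y z
  simp only [expectTri_apply, ← tensorOp_three_mul]
  constructor
  · rw [← mul_assoc, hr, smul_mul_assoc, Matrix.trace_smul, smul_eq_mul]
  · rw [← mul_assoc, Matrix.trace_mul_comm, ← mul_assoc, hl, smul_mul_assoc, Matrix.trace_smul,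
      smul_eq_mul]

/-- By Lagrange's theorem a proper subgroup has at most half the elements. -/
lemma two_mul_card_le_of_lt {G : Type*} [Group G] {H K : Subgroup G} [Finite K] (h : H < K) :
    2 * Nat.card H ≤ Nat.card K := by
  obtain ⟨m, hm⟩ := Subgroup.card_dvd_of_le h.le
  have hK : 0 < Nat.card K := Nat.card_pos
  have h0 : m ≠ 0 := by rintro rfl; omega
  have h1 : m ≠ 1 := by
    rintro rfl
    exact h.ne (Subgroup.eq_of_le_of_card_ge h.le (by omega))
  rw [hm, mul_comm]
  exact Nat.mul_le_mul_left _ (by omega)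

/-- Three independent generators: each of the three steps in the chain of subgroups generated by the
first `0, 1, 2, 3` of them at least doubles the order. -/
lemma eight_le_card {G : Type*} [Group G] {S : Subgroup G} [Finite S] {g : Fin 3 → G}
    (hg : Subgroup.closure (Set.range g) = S)
    (hi : ∀ j, g j ∉ Subgroup.closure (g '' {j}ᶜ)) : 8 ≤ Nat.card S := by
  have hS : ∀ j, g j ∈ S := fun j => hg ▸ Subgroup.subset_closure ⟨j, rfl⟩
  have step : ∀ (T : Set (Fin 3)) (j : Fin 3), j ∉ T →
      Subgroup.closure (g '' T) < Subgroup.closure (g '' insert j T) := by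
    intro T j hj
    refine lt_of_le_of_ne (Subgroup.closure_mono (Set.image_mono (Set.subset_insert _ _)))
      fun he => hi j ?_
    have h1 : g j ∈ Subgroup.closure (g '' insert j T) :=
      Subgroup.subset_closure ⟨j, Set.mem_insert _ _, rfl⟩
    rw [← he] at h1
    refine Subgroup.closure_mono (Set.image_mono ?_) h1
    rintro i hi rfl; exact hj hi
  have fin : ∀ T : Set (Fin 3), Finite (Subgroup.closure (g '' T)) := fun T =>
    Finite.Set.subset (S : Set G) (by
      rw [← hg]; exact Subgroup.closure_mono (Set.image_subset_range _ _))
  have h1 := two_mul_card_le_of_lt (step ∅ 0 (by simp))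
  have h2 := two_mul_card_le_of_lt (step {0} 1 (by simp))
  have h3 := two_mul_card_le_of_lt (step {1, 0} 2 (by simp))
  have e : Subgroup.closure (g '' insert 2 {1, 0}) = S := by
    rw [← hg, ← Set.image_univ]; congr 2; ext i; fin_cases i <;> simp
  rw [e] at h3
  have := fin ∅
  have h0 : 0 < Nat.card (Subgroup.closure (g '' ∅)) := Nat.card_pos
  simp only [insert_empty_eq] at *
  omega

/-- Two elements of a stabilizer group with the same Pauli label differ by a phase, hence are equal;
so the labels are as many as the elements. -/
lemma hasEightStabilizers_of_isStabilizerState {ψ : EuclideanSpace ℂ (Basis 3)}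
    (h : IsStabilizerState ψ) :
    HasEightStabilizers (expectTri (ketbra ψ)) := by
  obtain ⟨hn, S, hS, hfix⟩ := h
  choose k p hp using hS.pauli
  let lab : S → (Fin 3 → Fin 4) := fun s => p s s.2
  have hinj : Function.Injective lab := by
    rintro ⟨s, hs⟩ ⟨t, ht⟩ hst
    have hst' : p s hs = p t ht := hst
    have hu : I ^ k t ht ≠ 0 := pow_ne_zero _ I_ne_zero
    have e1 : (s : Op 3) = (I ^ k s hs * (I ^ k t ht)⁻¹) • (t : Op 3) := by
      rw [hp s hs, hp t ht, hst', smul_smul, inv_mul_cancel_right₀ hu]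
    have e2 : ((s * t⁻¹ : Matrix.unitaryGroup (Basis 3) ℂ) : Op 3) =
        (I ^ k s hs * (I ^ k t ht)⁻¹) • 1 := by
      have e3 : ((t * t⁻¹ : Matrix.unitaryGroup (Basis 3) ℂ) : Op 3) = 1 := by
        rw [mul_inv_cancel]; rfl
      have e4 : ((t : Op 3)) * ((t⁻¹ : Matrix.unitaryGroup (Basis 3) ℂ) : Op 3) = 1 := e3
      change (s : Op 3) * ((t⁻¹ : Matrix.unitaryGroup (Basis 3) ℂ) : Op 3) = _
      rw [e1, smul_mul_assoc, e4]
    have e5 := hS.phase _ (S.mul_mem hs (S.inv_mem ht)) _ e2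
    rw [e5, one_smul] at e1
    exact Subtype.ext (Subtype.ext e1)
  have : Finite S := Finite.of_injective lab hinj
  obtain ⟨g, hg, hi⟩ := hS.generators
  have h8 := eight_le_card hg hi
  have : Fintype S := Fintype.ofFinite S
  rw [Nat.card_eq_fintype_card] at h8
  obtain ⟨e⟩ : Nonempty (Fin 8 ↪ S) :=
    Function.Embedding.nonempty_of_card_le (by simpa using h8)
  refine ⟨fun i => (lab (e i) 0, lab (e i) 1, lab (e i) 2), ?_, ?_⟩
  · intro i j hij
    simp only [Prod.mk.injEq] at hij
    refine e.injective (hinj (funext fun l => ?_))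
    fin_cases l
    exacts [hij.1, hij.2.1, hij.2.2]
  · intro i
    refine ⟨(I ^ k (e i) (e i).2)⁻¹, stab_of_eigen hn ?_⟩
    have hu : I ^ k (e i) (e i).2 ≠ 0 := pow_ne_zero _ I_ne_zero
    have h1 := hfix (e i) (e i).2
    rw [hp _ (e i).2, Matrix.smul_mulVec] at h1
    rw [eq_inv_smul_iff₀ hu]
    exact h1

lemma expect_combo {n : ℕ} (ρ σ M : Op n) (a b : ℝ) :
    expect (a • ρ + b • σ) M = a * expect ρ M + b * expect σ M := by
  simp [expect, add_mul, Matrix.trace_add, Matrix.trace_smul]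

lemma convex_setOf_bell_le (A : Fin 3 → Fin 2 → M2) :
    Convex ℝ {ρ : Op 3 | S3 ρ A + R2 ρ A ≤ 6} := by
  intro ρ hρ σ hσ a b ha hb hab
  simp only [Set.mem_ofPred_eq] at *
  have : S3 (a • ρ + b • σ) A + R2 (a • ρ + b • σ) A =
      a * (S3 ρ A + R2 ρ A) + b * (S3 σ A + R2 σ A) := by
    simp only [S3, R2, corr3, expect_combo, Fin.sum_univ_two]; ring
  rw [this]
  nlinarith

end StabBell

theorem mainTheorem6 (A : Fin 3 → Fin 2 → Matrix (Fin 2) (Fin 2) ℂ)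
    (hA : ∀ p x, StabBell.IsDichotomic (A p x)) :
    (∀ ψ : EuclideanSpace ℂ (StabBell.Basis 3), StabBell.IsStabilizerState ψ →
      StabBell.S3 (StabBell.ketbra ψ) A + StabBell.R2 (StabBell.ketbra ψ) A ≤ 6) ∧
    (∀ ρ ∈ StabBell.stabilizerPolytope 3, StabBell.S3 ρ A + StabBell.R2 ρ A ≤ 6) := by
  have pure : ∀ ψ : EuclideanSpace ℂ (StabBell.Basis 3), StabBell.IsStabilizerState ψ →
      StabBell.S3 (StabBell.ketbra ψ) A + StabBell.R2 (StabBell.ketbra ψ) A ≤ 6 := by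
    intro ψ hψ
    rw [StabBell.S3_add_R2_eq_bell]
    exact StabBell.bell_le (StabBell.isState_ketbra hψ.1)
      (StabBell.hasEightStabilizers_of_isStabilizerState hψ) (hA 0) (hA 1) (hA 2)
  refine ⟨pure, fun ρ hρ => ?_⟩
  refine convexHull_min ?_ (StabBell.convex_setOf_bell_le A) hρ
  rintro _ ⟨ψ, hψ, rfl⟩
  exact pure ψ hψ
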